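/- Conventions. A labeled Delone set $T$ of $\mathbb R^d$ is the graph of a map from a uniformly discrete and relatively dense subset of $\mathbb R^d$ (its set of points) to a compact metric space of labels. Labeled Delone sets with labels in a fixed space carry the vague topology: two of them are close if, on a large ball around $0$, their points are in bijection with corresponding points and labels close. Write $T-x$ for the translate of $T$ by $-x$. A tiling space $\Omega$ is the hull $\overline{\{T-x : x\in\mathbb R^d\}}$ of a labeled Delone set, assumed minimal (every translation orbit is dense in $\Omega$). It is aperiodic if $T-x=T$ implies $x=0$ for $T\in\Omega$; it is uniquely ergodic if it has exactly one translation-invariant Borel probability measure $\mu$; it has finite local complexity (FLC) if for every $R$ there are, up to translation, only finitely many patches of radius $R$ in the elements of $\Omega$. A function $s$ on $\Omega$ is strongly pattern-equivariant (PE) if for some $R$ the value $s(T)$ depends only on the patch $T\cap B(0,R)$. A weak cocycle is a continuous map $\alpha:\Omega\times\mathbb R^d\to\mathbb R^d$ with $\alpha(T,x)+\alpha(T-x,y)=\alpha(T,x+y)$; it is a strong cocycle if $T\mapsto\alpha(T,v)$ is strongly PE for every $v$. The coboundary of a continuous $s:\Omega\to\mathbb R^d$ is $(T,v)\mapsto s(T-v)-s(T)$.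 $H^1_w(\Omega;\mathbb R^d)$ is the group of weak cocycles modulo coboundaries of continuous functions, and $H^1_s(\Omega;\mathbb R^d)$ is the group of strong cocycles modulo coboundaries of continuous strongly PE functions. The Ruelle–Sullivan map sends the class $[\alpha]$ to the $d\times d$ matrix $C_\mu[\alpha]$ of the linear map $v\mapsto\int_\Omega\alpha(T,v)\,d\mu(T)$; on $H^1_s$ it is composed with the natural map $H^1_s\to H^1_w$. A map $h:\Omega\to\Omega'$ of tiling spaces is the shape deformation induced by a cocycle $\alpha$ if, for all $T\in\Omega$ and $x\in\mathbb R^d$, the map $\alpha(T,\cdot)$ is a homeomorphism of $\mathbb R^d$ carrying the set of points of $T$ onto the set of points of $h(T)$, and $h(T-x)=h(T)-\alpha(T,x)$. Theorem. Let $\Omega$ be a uniquely ergodic tiling space with invariant probability measure $\mu$. (1) Let $c\in H^1_w(\Omega;\mathbb R^d)$ be such that $C_\mu(c)$ is invertible. Then there are a weak cocycle $\alpha_0$ representing $c$, a tiling space $\Omega'$ and a homeomorphism $h_{\alpha_0}:\Omega\to\Omega'$ that is a shape deformation induced by $\alpha_0$. (2) If moreover $\Omega$ has FLC and $c\in H^1_s(\Omega;\mathbb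 R^d)$ is such that $C_\mu(c)$ is invertible, then there are a strong cocycle $\alpha_0$ representing $c$ in $H^1_s(\Omega;\mathbb R^d)$, an FLC tiling space $\Omega'$ and a homeomorphism $h_{\alpha_0}:\Omega\to\Omega'$ that is a shape deformation induced by $\alpha_0$. In both cases, $\Omega'$ is aperiodic if $\Omega$ is. -/

import Mathlib

open scoped Topology CompactlySupported
open MeasureTheory

universe u

/-- A labeled Delone set of `ℝ^d` with labels in `X`: the graph, as a set of pairs
`(point, label)`, of a map from a uniformly discrete and relatively dense set of points to `X`.
(Uniform discreteness is required of distinct pairs, so that no point carries two labels.) -/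
@[ext]
structure LabeledDelone (d : ℕ) (X : Type u) where
  carrier : Set (EuclideanSpace ℝ (Fin d) × X)
  uniformlyDiscrete : ∃ r : ℝ, 0 < r ∧
    ∀ p ∈ carrier, ∀ q ∈ carrier, p ≠ q → r ≤ dist p.1 q.1
  relativelyDense : ∃ R : ℝ, 0 < R ∧
    ∀ x : EuclideanSpace ℝ (Fin d), ∃ p ∈ carrier, dist p.1 x ≤ R

namespace LabeledDelone

variable {d : ℕ} {X : Type u}

/-- The underlying Delone set, without labels. -/
def points (T : LabeledDelone d X) : Set (EuclideanSpace ℝ (Fin d)) := Prod.fst '' T.carrier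

/-- The translate `T - x`. -/
def translate (T : LabeledDelone d X) (x : EuclideanSpace ℝ (Fin d)) : LabeledDelone d X where
  carrier := (fun p => (p.1 - x, p.2)) '' T.carrier
  uniformlyDiscrete := by
    obtain ⟨r, hr, h⟩ := T.uniformlyDiscrete
    refine ⟨r, hr, ?_⟩
    rintro _ ⟨p, hp, rfl⟩ _ ⟨q, hq, rfl⟩ hpq
    simpa using h p hp q hq (by rintro rfl; exact hpq rfl)
  relativelyDense := by
    obtain ⟨R, hR, h⟩ := T.relativelyDense
    refine ⟨R, hR, fun y => ?_⟩
    obtain ⟨p, hp, h'⟩ := h (y + x)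
    refine ⟨_, ⟨p, hp, rfl⟩, ?_⟩
    rw [dist_eq_norm] at h' ⊢
    convert h' using 2
    simp only
    abel

/-- The patch `T ∩ B(0, R)`. -/
def patch (T : LabeledDelone d X) (R : ℝ) : Set (EuclideanSpace ℝ (Fin d) × X) :=
  {p ∈ T.carrier | ‖p.1‖ < R}

theorem translate_translate (T : LabeledDelone d X) (x y : EuclideanSpace ℝ (Fin d)) :
    (T.translate x).translate y = T.translate (x + y) := by
  refine LabeledDelone.ext ?_
  simp only [translate, Set.image_image, sub_sub]

variable [MetricSpace X]

/-- The integral of a test function against the sum of the Dirac masses at the labeled points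
of `T`; for each `T` and `f` only finitely many terms are nonzero. -/
noncomputable def eval (f : C_c(EuclideanSpace ℝ (Fin d) × X, ℝ)) (T : LabeledDelone d X) : ℝ :=
  ∑ᶠ p ∈ T.carrier, f p

/-- The vague topology on labeled Delone sets: `T` and `T'` are close if, on a large ball around
the origin, their labeled points are in one-to-one correspondence, with corresponding points
and labels close to each other. -/
noncomputable instance : TopologicalSpace (LabeledDelone d X) :=
  ⨅ f : C_c(EuclideanSpace ℝ (Fin d) × X, ℝ), TopologicalSpace.induced (eval f) inferInstance

noncomputable instance : MeasurableSpace (LabeledDelone d X) := borel _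

instance : BorelSpace (LabeledDelone d X) := ⟨rfl⟩

/-- The hull of `T`: the closure of its translation orbit. -/
def hull (T : LabeledDelone d X) : Set (LabeledDelone d X) :=
  closure (Set.range T.translate)

theorem continuous_eval (f : C_c(EuclideanSpace ℝ (Fin d) × X, ℝ)) :
    Continuous (eval f : LabeledDelone d X → ℝ) :=
  continuous_iInf_dom (i := f) continuous_induced_dom

theorem le_nhds_iff (l : Filter (LabeledDelone d X)) (T : LabeledDelone d X) :
    l ≤ 𝓝 T ↔ ∀ f : C_c(EuclideanSpace ℝ (Fin d) × X, ℝ),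
      Filter.Tendsto (eval f) l (𝓝 (eval f T)) := by
  rw [nhds_iInf, le_iInf_iff]
  refine forall_congr' fun f => ?_
  rw [nhds_induced, Filter.tendsto_iff_comap]

theorem continuous_translate (x : EuclideanSpace ℝ (Fin d)) :
    Continuous (fun T : LabeledDelone d X => T.translate x) := by
  refine continuous_iInf_rng.2 fun f => continuous_induced_rng.2 ?_
  let φ : EuclideanSpace ℝ (Fin d) × X ≃ₜ EuclideanSpace ℝ (Fin d) × X :=
    (Homeomorph.subRight x).prodCongr (Homeomorph.refl X)
  let g : C_c(EuclideanSpace ℝ (Fin d) × X, ℝ) :=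
    ⟨⟨f ∘ φ, f.continuous.comp φ.continuous⟩, f.hasCompactSupport.comp_homeomorph φ⟩
  convert continuous_eval g using 1
  ext T
  exact finsum_mem_image (φ.injective.injOn)

theorem translate_mem_hull {T S : LabeledDelone d X} (hS : S ∈ T.hull)
    (x : EuclideanSpace ℝ (Fin d)) : S.translate x ∈ T.hull := by
  refine map_mem_closure (f := fun T : LabeledDelone d X => T.translate x)
    (continuous_translate x) hS ?_
  rintro _ ⟨y, rfl⟩
  exact ⟨y + x, (T.translate_translate y x).symm⟩

theorem exists_card_le {K : Set (EuclideanSpace ℝ (Fin d) × X)} (hK : IsCompact K) {r : ℝ}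
    (hr : 0 < r) : ∃ N : ℕ, ∀ S : Set (EuclideanSpace ℝ (Fin d) × X),
      (∀ p ∈ S, ∀ q ∈ S, p ≠ q → r ≤ dist p.1 q.1) → (S ∩ K).Finite ∧ (S ∩ K).ncard ≤ N := by
  obtain ⟨t, -, htf, ht⟩ := (hK.image continuous_fst).finite_cover_balls (half_pos hr)
  have h : ∀ p ∈ K, ∃ c ∈ t, p.1 ∈ Metric.ball c (r / 2) := fun p hp => by
    simpa using ht ⟨p, hp, rfl⟩
  choose! c hct hc using h
  refine ⟨t.ncard, fun S hS => ?_⟩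
  have hmaps : Set.MapsTo c (S ∩ K) t := fun p hp => hct p hp.2
  have hinj : Set.InjOn c (S ∩ K) := by
    intro p hp q hq hpq
    by_contra hne
    have h1 := hS p hp.1 q hq.1 hne
    have h2 := hc p hp.2
    have h3 := hc q hq.2
    rw [← hpq] at h3
    rw [Metric.mem_ball] at h2 h3
    linarith [dist_triangle_right p.1 q.1 (c p)]
  exact ⟨Set.Finite.of_injOn hmaps hinj htf,
    Set.ncard_le_ncard_of_injOn c hmaps hinj htf⟩

theorem finite_inter (T : LabeledDelone d X) {K : Set (EuclideanSpace ℝ (Fin d) × X)}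
    (hK : IsCompact K) : (T.carrier ∩ K).Finite := by
  obtain ⟨r, hr, h⟩ := T.uniformlyDiscrete
  obtain ⟨N, hN⟩ := exists_card_le hK hr
  exact (hN _ h).1

theorem eval_eq_sum (f : C_c(EuclideanSpace ℝ (Fin d) × X, ℝ)) (T : LabeledDelone d X)
    (F : Finset (EuclideanSpace ℝ (Fin d) × X)) (hF : ∀ p ∈ F, p ∈ T.carrier)
    (hF' : ∀ p ∈ T.carrier, f p ≠ 0 → p ∈ F) : eval f T = ∑ p ∈ F, f p := by
  refine finsum_mem_eq_sum_of_inter_support_eq _ ?_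
  ext p
  simp only [Set.mem_inter_iff, Function.mem_support, Finset.mem_coe]
  exact ⟨fun h => ⟨hF' p h.1 h.2, h.2⟩, fun h => ⟨hF p h.1, h.2⟩⟩

variable [CompactSpace X]

instance : T2Space (LabeledDelone d X) := by
  have key : ∀ T T' : LabeledDelone d X, (∃ p ∈ T.carrier, p ∉ T'.carrier) →
      ∃ f : C_c(EuclideanSpace ℝ (Fin d) × X, ℝ), eval f T ≠ eval f T' := by
    rintro T T' ⟨p, hp, hp'⟩
    obtain ⟨K, hK, hKp⟩ := exists_compact_mem_nhds p
    have hfin := T'.finite_inter hK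
    obtain ⟨f, hf1, hf0, hfc, hf⟩ := exists_continuous_one_zero_of_isCompact
      (isCompact_singleton (x := p))
      (isOpen_interior.sdiff hfin.isClosed : IsOpen (interior K \ (T'.carrier ∩ K))).isClosed_compl
      (by
        rw [Set.disjoint_singleton_left]
        exact fun h => h ⟨mem_interior_iff_mem_nhds.2 hKp, fun h => hp' h.1⟩)
    refine ⟨⟨f, hfc⟩, ?_⟩
    have h0 : eval ⟨f, hfc⟩ T' = 0 := by
      rw [eval_eq_sum ⟨f, hfc⟩ T' ∅ (by simp)]
      · simp
      · intro q hq hfq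
        refine absurd (hf0 fun h => h.2 ⟨hq, interior_subset h.1⟩) hfq
    have h1 : 1 ≤ eval ⟨f, hfc⟩ T := by
      rw [eval_eq_sum ⟨f, hfc⟩ T (T.finite_inter hfc).toFinset (by simp +contextual)]
      · have : f p = 1 := hf1 rfl
        rw [← this]
        refine Finset.single_le_sum (f := fun q => f q) (fun q _ => (hf q).1) ?_
        simp only [Set.Finite.mem_toFinset]
        exact ⟨hp, subset_tsupport _ (by simp [this])⟩
      · intro q hq hfq
        simp only [Set.Finite.mem_toFinset]
        exact ⟨hq, subset_tsupport _ hfq⟩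
    linarith
  refine ⟨fun T T' hne => ?_⟩
  have : ∃ f : C_c(EuclideanSpace ℝ (Fin d) × X, ℝ), eval f T ≠ eval f T' := by
    by_cases h : T.carrier ⊆ T'.carrier
    · by_cases h' : T'.carrier ⊆ T.carrier
      · exact absurd (LabeledDelone.ext (h.antisymm h')) hne
      · obtain ⟨f, hf⟩ := key T' T (Set.not_subset.1 h')
        exact ⟨f, hf.symm⟩
    · exact key T T' (Set.not_subset.1 h)
  obtain ⟨f, hf⟩ := this
  exact separated_by_continuous (continuous_eval f) hf

theorem isCompact_setOf (r R : ℝ) (hr : 0 < r) (hR : 0 < R) :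
    IsCompact {T : LabeledDelone d X |
      (∀ p ∈ T.carrier, ∀ q ∈ T.carrier, p ≠ q → r ≤ dist p.1 q.1) ∧
      ∀ x : EuclideanSpace ℝ (Fin d), ∃ p ∈ T.carrier, dist p.1 x ≤ R} := by
  rw [isCompact_iff_ultrafilter_le_nhds']
  intro U hU
  let S : Set (EuclideanSpace ℝ (Fin d) × X) :=
    {p | ∀ V ∈ 𝓝 p, ∀ᶠ T in (U : Filter (LabeledDelone d X)), (T.carrier ∩ V).Nonempty}
  have hlim : ∀ (g : LabeledDelone d X → EuclideanSpace ℝ (Fin d) × X)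
      (K : Set (EuclideanSpace ℝ (Fin d) × X)), IsCompact K →
      (∀ᶠ T in (U : Filter (LabeledDelone d X)), g T ∈ T.carrier ∩ K) →
      ∃ p ∈ K, p ∈ S ∧ Filter.Tendsto g U (𝓝 p) := by
    intro g K hK hg
    obtain ⟨p, hpK, hp⟩ := isCompact_iff_ultrafilter_le_nhds'.1 hK (U.map g)
      (show ∀ᶠ T in (U : Filter (LabeledDelone d X)), g T ∈ K from hg.mono fun T hT => hT.2)
    refine ⟨p, hpK, fun V hV => ?_, hp⟩
    filter_upwards [hg, (show Filter.Tendsto g U (𝓝 p) from hp) hV] with T hT hT'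
    exact ⟨g T, hT.1, hT'⟩
  have hsep : ∀ p ∈ S, ∀ q ∈ S, p ≠ q → r ≤ dist p.1 q.1 := by
    intro p hp q hq hpq
    refine le_of_forall_pos_le_add fun ε hε => ?_
    obtain ⟨A, B, hA, hB, hpA, hqB, hAB⟩ := t2_separation hpq
    have h1 := hp _ (Filter.inter_mem (hA.mem_nhds hpA) (Metric.ball_mem_nhds p (half_pos hε)))
    have h2 := hq _ (Filter.inter_mem (hB.mem_nhds hqB) (Metric.ball_mem_nhds q (half_pos hε)))
    obtain ⟨T, ⟨a, haT, haA, ha⟩, ⟨b, hbT, hbB, hb⟩, hT⟩ := (h1.and (h2.and hU)).exists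
    have h3 := hT.1 a haT b hbT (fun h => Set.disjoint_left.1 hAB haA (h ▸ hbB))
    rw [Metric.mem_ball, Prod.dist_eq, max_lt_iff] at ha hb
    have h4 := dist_triangle4 a.1 p.1 q.1 b.1
    rw [dist_comm q.1 b.1] at h4
    linarith [ha.1, hb.1]
  have hdense : ∀ x : EuclideanSpace ℝ (Fin d), ∃ p ∈ S, dist p.1 x ≤ R := by
    intro x
    have h : ∀ T : LabeledDelone d X, ∃ p,
        (∀ x : EuclideanSpace ℝ (Fin d), ∃ p ∈ T.carrier, dist p.1 x ≤ R) →
          p ∈ T.carrier ∧ dist p.1 x ≤ R := by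
      intro T
      by_cases hT : ∀ x : EuclideanSpace ℝ (Fin d), ∃ p ∈ T.carrier, dist p.1 x ≤ R
      · obtain ⟨p, hp⟩ := hT x
        exact ⟨p, fun _ => hp⟩
      · obtain ⟨_, -, h⟩ := T.relativelyDense
        obtain ⟨p, -⟩ := h x
        exact ⟨p, fun h => absurd h hT⟩
    choose g hg using h
    obtain ⟨p, hpK, hpS, -⟩ := hlim g (Metric.closedBall x R ×ˢ Set.univ)
      ((isCompact_closedBall x R).prod isCompact_univ) (by
        filter_upwards [hU] with T hT
        exact ⟨(hg T hT.2).1, (hg T hT.2).2, trivial⟩)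
    exact ⟨p, hpS, hpK.1⟩
  refine ⟨⟨S, ⟨r, hr, hsep⟩, ⟨R, hR, hdense⟩⟩, ⟨hsep, hdense⟩, (le_nhds_iff _ _).2 fun f => ?_⟩
  have hK : IsCompact (tsupport f) := f.hasCompactSupport
  obtain ⟨N, hN⟩ := exists_card_le hK hr
  obtain ⟨n, hn⟩ : ∃ n ∈ Set.Iic N, ∀ᶠ T in (U : Filter (LabeledDelone d X)),
      (T.carrier ∩ tsupport f).ncard = n := by
    have := (Ultrafilter.eventually_exists_mem_iff (f := U) (his := Set.finite_Iic N)
      (P := fun n (T : LabeledDelone d X) => (T.carrier ∩ tsupport f).ncard = n)).1 (by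
        filter_upwards [hU] with T hT
        exact ⟨_, (hN _ hT.1).2, rfl⟩)
    exact this
  have henum : ∀ T : LabeledDelone d X, ∃ e : Fin n → EuclideanSpace ℝ (Fin d) × X,
      (T.carrier ∩ tsupport f).ncard = n →
        Function.Injective e ∧ Set.range e = T.carrier ∩ tsupport f := by
    intro T
    by_cases h : (T.carrier ∩ tsupport f).ncard = n
    · have hfin := T.finite_inter hK
      have hcard : hfin.toFinset.card = n := by
        rw [← h, Set.ncard_eq_toFinset_card _ hfin]
      refine ⟨fun i => (hfin.toFinset.equivFinOfCardEq hcard).symm i, fun _ => ⟨?_, ?_⟩⟩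
      · exact Subtype.val_injective.comp (Equiv.injective _)
      · ext p
        simp only [Set.mem_range]
        constructor
        · rintro ⟨i, rfl⟩
          exact hfin.mem_toFinset.1 ((hfin.toFinset.equivFinOfCardEq hcard).symm i).2
        · intro hp
          exact ⟨hfin.toFinset.equivFinOfCardEq hcard ⟨p, by simpa using hp⟩, by simp⟩
    · obtain ⟨_, -, h'⟩ := T.relativelyDense
      obtain ⟨p, -⟩ := h' 0
      exact ⟨fun _ => p, fun h' => absurd h' h⟩
  choose e he using henum
  have hq : ∀ i : Fin n, ∃ p ∈ tsupport f, p ∈ S ∧ Filter.Tendsto (fun T => e T i) U (𝓝 p) := by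
    intro i
    refine hlim _ _ hK ?_
    filter_upwards [hn.2] with T hT
    rw [← (he T hT).2]
    exact ⟨i, rfl⟩
  choose q hqK hqS hqlim using hq
  have hqinj : Function.Injective q := by
    intro i j hij
    by_contra hne
    have h1 : Filter.Tendsto (fun T => dist (e T i).1 (e T j).1) U (𝓝 (dist (q i).1 (q j).1)) :=
      ((continuous_fst.tendsto _).comp (hqlim i)).dist ((continuous_fst.tendsto _).comp (hqlim j))
    have h2 : r ≤ dist (q i).1 (q j).1 := by
      refine ge_of_tendsto h1 ?_
      filter_upwards [hU, hn.2] with T hT hT'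
      have hr := (he T hT').2
      refine hT.1 _ ?_ _ ?_ ((he T hT').1.ne hne)
      · exact (hr.subset ⟨i, rfl⟩).1
      · exact (hr.subset ⟨j, rfl⟩).1
    rw [hij, dist_self] at h2
    linarith
  classical
  have hS : eval f ⟨S, ⟨r, hr, hsep⟩, ⟨R, hR, hdense⟩⟩ = ∑ i, f (q i) := by
    rw [eval_eq_sum f _ (Finset.univ.image q) (by simpa using hqS),
      Finset.sum_image hqinj.injOn]
    intro p hp hfp
    by_contra hpq
    have hpq' : ∀ i, q i ≠ p := by simpa using hpq
    have hV : ∃ V ∈ 𝓝 p, ∀ i, ∀ᶠ T in (U : Filter (LabeledDelone d X)), e T i ∉ V := by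
      have : ∀ i, ∃ V ∈ 𝓝 p, ∀ᶠ T in (U : Filter (LabeledDelone d X)), e T i ∉ V := by
        intro i
        obtain ⟨A, B, hA, hB, hqA, hpB, hAB⟩ := t2_separation (hpq' i)
        refine ⟨B, hB.mem_nhds hpB, ?_⟩
        filter_upwards [hqlim i (hA.mem_nhds hqA)] with T hT
        exact fun h => Set.disjoint_left.1 hAB hT h
      choose V hV hV' using this
      refine ⟨⋂ i, V i, Filter.iInter_mem.2 hV, fun i => ?_⟩
      filter_upwards [hV' i] with T hT h
      exact hT (Set.mem_iInter.1 h i)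
    obtain ⟨V, hV, hV'⟩ := hV
    have h1 := hp _ (Filter.inter_mem hV (f.continuous.isOpen_support.mem_nhds hfp))
    obtain ⟨T, ⟨a, haT, haV, haf⟩, hT, hT'⟩ :=
      (h1.and ((Filter.eventually_all.2 hV').and hn.2)).exists
    obtain ⟨i, rfl⟩ := (he T hT').2.superset ⟨haT, subset_tsupport _ haf⟩
    exact hT i haV
  rw [hS]
  have hsum : Filter.Tendsto (fun T => ∑ i, f (e T i)) U (𝓝 (∑ i, f (q i))) :=
    tendsto_finsetSum _ fun i _ => (f.continuous.tendsto _).comp (hqlim i)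
  refine hsum.congr' ?_
  filter_upwards [hn.2] with T hT
  obtain ⟨hi, hrange⟩ := he T hT
  rw [eval_eq_sum f T (Finset.univ.image (e T)), Finset.sum_image hi.injOn]
  · simp only [Finset.mem_image, Finset.mem_univ, true_and]
    rintro _ ⟨i, rfl⟩
    exact (hrange.subset ⟨i, rfl⟩).1
  · intro p hp hfp
    obtain ⟨i, rfl⟩ := hrange.superset ⟨hp, subset_tsupport _ hfp⟩
    simp

theorem isCompact_hull (T : LabeledDelone d X) : IsCompact T.hull := by
  obtain ⟨r, hr, h⟩ := T.uniformlyDiscrete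
  obtain ⟨R, hR, h'⟩ := T.relativelyDense
  have hK := isCompact_setOf (d := d) (X := X) r R hr hR
  refine hK.of_isClosed_subset isClosed_closure (closure_minimal ?_ hK.isClosed)
  rintro _ ⟨x, rfl⟩
  refine ⟨?_, fun y => ?_⟩
  · rintro _ ⟨p, hp, rfl⟩ _ ⟨q, hq, rfl⟩ hpq
    simpa using h p hp q hq (by rintro rfl; exact hpq rfl)
  · obtain ⟨p, hp, hpy⟩ := h' (y + x)
    refine ⟨_, ⟨p, hp, rfl⟩, ?_⟩
    rw [dist_eq_norm] at hpy ⊢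
    convert hpy using 2
    simp only
    abel

end LabeledDelone

/-- A (minimal) tiling space: the hull of a labeled Delone set, in which every translation orbit
is dense. -/
structure TilingSpace (d : ℕ) (X : Type u) [MetricSpace X] where
  carrier : Set (LabeledDelone d X)
  exists_hull_eq : ∃ T : LabeledDelone d X, T.hull = carrier
  minimal : ∀ T ∈ carrier, carrier ⊆ T.hull

namespace TilingSpace

variable {d : ℕ} {X : Type u} [MetricSpace X]

instance : CoeSort (TilingSpace d X) (Type u) := ⟨fun Ω => Ω.carrier⟩

/-- The translation action: `Ω.translate T x` is `T - x`. -/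
def translate (Ω : TilingSpace d X) (T : Ω) (x : EuclideanSpace ℝ (Fin d)) : Ω :=
  ⟨T.1.translate x, by
    obtain ⟨S, hS⟩ := Ω.exists_hull_eq
    exact hS.subset (LabeledDelone.translate_mem_hull (hS.superset T.2) x)⟩

theorem continuous_translate (Ω : TilingSpace d X) (x : EuclideanSpace ℝ (Fin d)) :
    Continuous (fun T : Ω => Ω.translate T x) :=
  ((LabeledDelone.continuous_translate x).comp continuous_subtype_val).subtype_mk _

/-- No tiling has a nonzero period. -/
def IsAperiodic (Ω : TilingSpace d X) : Prop :=
  ∀ (T : Ω) (x : EuclideanSpace ℝ (Fin d)), Ω.translate T x = T → x = 0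

/-- Finite local complexity: for each radius `R`, up to translation only finitely many patches
of radius `R` occur in the tilings of `Ω`. (The patch of `T` around `x` is, up to translation,
the patch of `T - x ∈ Ω` around the origin.) -/
def IsFLC (Ω : TilingSpace d X) : Prop :=
  ∀ R : ℝ, ∃ F : Set (Set (EuclideanSpace ℝ (Fin d) × X)), F.Finite ∧
    ∀ T : Ω, ∃ P ∈ F, ∃ v : EuclideanSpace ℝ (Fin d),
      T.1.patch R = (fun p => (p.1 + v, p.2)) '' P

/-- A function on `Ω` is strongly pattern-equivariant if its value at `T` depends only on the
patch of `T` of some fixed radius around the origin. -/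
def IsStronglyPE (Ω : TilingSpace d X) (s : Ω → EuclideanSpace ℝ (Fin d)) : Prop :=
  ∃ R : ℝ, ∀ T T' : Ω, T.1.patch R = T'.1.patch R → s T = s T'

theorem IsStronglyPE.add {Ω : TilingSpace d X} {s t : Ω → EuclideanSpace ℝ (Fin d)}
    (hs : Ω.IsStronglyPE s) (ht : Ω.IsStronglyPE t) :
    Ω.IsStronglyPE (fun T => s T + t T) := by
  obtain ⟨R, hR⟩ := hs
  obtain ⟨R', hR'⟩ := ht
  have mono : ∀ {r r' : ℝ}, r ≤ r' → ∀ T T' : Ω, T.1.patch r' = T'.1.patch r' →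
      T.1.patch r = T'.1.patch r := by
    intro r r' hr T T' h
    ext p
    have hp := Set.ext_iff.1 h p
    simp only [LabeledDelone.patch, Set.mem_ofPred_eq] at hp ⊢
    constructor
    · exact fun h1 => ⟨(hp.1 ⟨h1.1, h1.2.trans_le hr⟩).1, h1.2⟩
    · exact fun h1 => ⟨(hp.2 ⟨h1.1, h1.2.trans_le hr⟩).1, h1.2⟩
  exact ⟨max R R', fun T T' h => congrArg₂ (· + ·) (hR T T' (mono (le_max_left _ _) T T' h))
    (hR' T T' (mono (le_max_right _ _) T T' h))⟩

theorem IsStronglyPE.neg {Ω : TilingSpace d X} {s : Ω → EuclideanSpace ℝ (Fin d)}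
    (hs : Ω.IsStronglyPE s) : Ω.IsStronglyPE (fun T => -s T) := by
  obtain ⟨R, hR⟩ := hs
  exact ⟨R, fun T T' h => congrArg (-·) (hR T T' h)⟩

/-- Weak dynamical `1`-cocycles with values in `ℝ^d`: continuous functions `α` on `Ω × ℝ^d`
such that `α(T, x) + α(T - x, y) = α(T, x + y)`. -/
def weakCocycles (Ω : TilingSpace d X) :
    AddSubgroup C(Ω × EuclideanSpace ℝ (Fin d), EuclideanSpace ℝ (Fin d)) where
  carrier := {α | ∀ T x y, α (T, x) + α (Ω.translate T x, y) = α (T, x + y)}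
  zero_mem' := by simp
  add_mem' := by
    intro α β hα hβ T x y
    simp only [ContinuousMap.add_apply, ← hα T x y, ← hβ T x y]
    abel
  neg_mem' := by
    intro α hα T x y
    simp only [ContinuousMap.neg_apply, ← hα T x y, neg_add]

/-- Weak coboundaries: cocycles of the form `(T, v) ↦ s(T - v) - s(T)` with `s` continuous. -/
def weakCoboundaries (Ω : TilingSpace d X) : AddSubgroup Ω.weakCocycles where
  carrier := {α | ∃ s : C(Ω, EuclideanSpace ℝ (Fin d)),
    ∀ T v, α.1 (T, v) = s (Ω.translate T v) - s T}
  zero_mem' := ⟨0, by simp⟩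
  add_mem' := by
    rintro α β ⟨s, hs⟩ ⟨t, ht⟩
    refine ⟨s + t, fun T v => ?_⟩
    simp only [AddSubgroup.coe_add, ContinuousMap.add_apply, hs, ht]
    abel
  neg_mem' := by
    rintro α ⟨s, hs⟩
    refine ⟨-s, fun T v => ?_⟩
    simp only [AddSubgroup.coe_neg, ContinuousMap.neg_apply, hs]
    abel

/-- Strong cocycles: cocycles `α` such that `T ↦ α(T, v)` is strongly pattern-equivariant for
each `v`. -/
def strongCocycles (Ω : TilingSpace d X) : AddSubgroup Ω.weakCocycles where
  carrier := {α | ∀ v, Ω.IsStronglyPE fun T => α.1 (T, v)}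
  zero_mem' := fun _ => ⟨0, fun _ _ _ => rfl⟩
  add_mem' := fun hα hβ v => (hα v).add (hβ v)
  neg_mem' := fun hα v => (hα v).neg

/-- Strong coboundaries: cocycles of the form `(T, v) ↦ s(T - v) - s(T)` with `s` continuous
and strongly pattern-equivariant. -/
def strongCoboundaries (Ω : TilingSpace d X) : AddSubgroup Ω.strongCocycles where
  carrier := {α | ∃ s : C(Ω, EuclideanSpace ℝ (Fin d)), Ω.IsStronglyPE s ∧
    ∀ T v, α.1.1 (T, v) = s (Ω.translate T v) - s T}
  zero_mem' := ⟨0, ⟨0, fun _ _ _ => rfl⟩, by simp⟩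
  add_mem' := by
    rintro α β ⟨s, hs', hs⟩ ⟨t, ht', ht⟩
    refine ⟨s + t, hs'.add ht', fun T v => ?_⟩
    simp only [AddSubgroup.coe_add, ContinuousMap.add_apply, hs, ht]
    abel
  neg_mem' := by
    rintro α ⟨s, hs', hs⟩
    refine ⟨-s, hs'.neg, fun T v => ?_⟩
    simp only [AddSubgroup.coe_neg, ContinuousMap.neg_apply, hs]
    abel

/-- The weak cohomology group `H^1_w(Ω; ℝ^d)`. -/
abbrev H1w (Ω : TilingSpace d X) : Type u := Ω.weakCocycles ⧸ Ω.weakCoboundaries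

/-- The strong cohomology group `H^1_s(Ω; ℝ^d)`. -/
abbrev H1s (Ω : TilingSpace d X) : Type u := Ω.strongCocycles ⧸ Ω.strongCoboundaries

/-- The natural map `H^1_s(Ω; ℝ^d) → H^1_w(Ω; ℝ^d)`. -/
noncomputable def strongToWeak (Ω : TilingSpace d X) : Ω.H1s →+ Ω.H1w :=
  QuotientAddGroup.map _ _ Ω.strongCocycles.subtype (by
    rintro α ⟨s, -, hs⟩
    exact ⟨s, hs⟩)

/-- A translation-invariant Borel probability measure on `Ω`. -/
structure InvariantMeasure (Ω : TilingSpace d X) where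
  toMeasure : Measure Ω
  isProbabilityMeasure : IsProbabilityMeasure toMeasure
  map_translate : ∀ x : EuclideanSpace ℝ (Fin d),
    toMeasure.map (fun T => Ω.translate T x) = toMeasure

/-- There is exactly one translation-invariant Borel probability measure on `Ω`. -/
def IsUniquelyErgodic (Ω : TilingSpace d X) : Prop :=
  ∃ μ : Ω.InvariantMeasure, ∀ ν : Ω.InvariantMeasure, ν = μ

variable [CompactSpace X]

instance (Ω : TilingSpace d X) : CompactSpace Ω := by
  obtain ⟨T, hT⟩ := Ω.exists_hull_eq
  exact isCompact_iff_compactSpace.1 (hT ▸ T.isCompact_hull)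

theorem integrable (Ω : TilingSpace d X) (μ : Ω.InvariantMeasure) {f : Ω → ℝ}
    (hf : Continuous f) : Integrable f μ.toMeasure :=
  haveI := μ.isProbabilityMeasure
  hf.integrable_of_hasCompactSupport (HasCompactSupport.of_compactSpace f)

/-- The Ruelle--Sullivan map: the class of a cocycle `α` is sent to the matrix of the linear map
`v ↦ ∫ α(T, v) dμ(T)`. If `α` is the integral of a closed `1`-form `ω`, that is
`α(T, v) = ∫₀¹ ω(T - t v) v dt`, then by invariance of `μ` this is the matrix `∫ ω(T) dμ(T)`. -/
noncomputable def ruelleSullivan (Ω : TilingSpace d X) (μ : Ω.InvariantMeasure) :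
    Ω.H1w →+ Matrix (Fin d) (Fin d) ℝ :=
  QuotientAddGroup.lift _
    { toFun := fun α => Matrix.of fun i j =>
        ∫ T, α.1 (T, EuclideanSpace.single j 1) i ∂μ.toMeasure
      map_add' := by
        intro α β
        ext i j
        simp only [AddSubgroup.coe_add, ContinuousMap.add_apply, PiLp.add_apply, Matrix.of_apply,
          Matrix.add_apply]
        exact integral_add (Ω.integrable μ (by fun_prop)) (Ω.integrable μ (by fun_prop))
      map_zero' := by
        ext i j
        simp }
    (by
      rintro α ⟨s, hs⟩
      ext i j
      have hc : Continuous fun T : Ω => s T i := by fun_prop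
      have hm := Ω.continuous_translate (EuclideanSpace.single j 1)
      simp only [AddMonoidHom.coe_mk, ZeroHom.coe_mk, Matrix.of_apply, Matrix.zero_apply, hs,
        PiLp.sub_apply]
      have hcm : Continuous fun T : Ω => s (Ω.translate T (EuclideanSpace.single j 1)) i :=
        hc.comp hm
      rw [integral_sub (Ω.integrable μ hcm) (Ω.integrable μ hc), sub_eq_zero]
      conv_rhs => rw [← μ.map_translate (EuclideanSpace.single j 1)]
      exact (integral_map hm.measurable.aemeasurable hc.aestronglyMeasurable).symm)

end TilingSpace

/-- `h : Ω → Ω'` is the shape deformation induced by the cocycle `α`: each `α(T, ·)` is a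
homeomorphism of `ℝ^d` that carries the points of `T` to the points of `h(T)`, and
`h(T - x) = h(T) - α(T, x)`. -/
structure IsShapeDeformation {d : ℕ} {X Y : Type u} [MetricSpace X] [MetricSpace Y]
    (Ω : TilingSpace d X) (Ω' : TilingSpace d Y) (α : Ω.weakCocycles) (h : Ω → Ω') : Prop where
  isHomeomorph : ∀ T, IsHomeomorph fun x => α.1 (T, x)
  image_points : ∀ T : Ω, (fun x => α.1 (T, x)) '' T.1.points = (h T).1.points
  map_translate : ∀ T x, h (Ω.translate T x) = Ω'.translate (h T) (α.1 (T, x))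

/-!
Averaging a cocycle over balls of a large radius does not change its class and, by unique
ergodicity, makes its values uniformly close, on bounded sets of vectors, to the linear map
`C_μ(c)`. Averaging once more, at unit scale against a Lipschitz density, turns this closeness into
closeness in the Lipschitz sense; hence if `C_μ(c)` is invertible, all the maps `α(T, ·)` are
bi-Lipschitz bijections of `ℝ^d`, with uniform constants.

The deformation of `T` is the image of its points under `α(T, ·)`, and injectivity is a matter of
choosing the labels. In the weak case the image of the point `x` of `T` is labeled by `T - x`. In
the FLC case it is labeled by the patch of `T - x` of a large radius `ρ`. A Baire category argument
shows that `α(T, v)` depends on the patch of `T` of radius `‖v‖ + R₀` only; hence once two tilings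
with the same deformation agree on a ball, their labels agree inside that ball and force the tilings
to agree on a slightly larger ball.
-/

local notation "𝔼" d:max => EuclideanSpace ℝ (Fin d)

namespace LabeledDelone

section Carrier

variable {d : ℕ} {X : Type u} {T : LabeledDelone d X}

/-- The uniform discreteness required of labeled Delone sets, with an explicit constant `r`. -/
def UniformlyDiscreteWith (S : Set (𝔼 d × X)) (r : ℝ) : Prop :=
  ∀ p ∈ S, ∀ q ∈ S, p ≠ q → r ≤ dist p.1 q.1

/-- The relative density required of labeled Delone sets, with an explicit constant `R`. -/
def RelativelyDenseWith (S : Set (𝔼 d × X)) (R : ℝ) : Prop :=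
  ∀ x : 𝔼 d, ∃ p ∈ S, dist p.1 x ≤ R

theorem mem_points {x : 𝔼 d} : x ∈ T.points ↔ ∃ l, (x, l) ∈ T.carrier := by
  simp [points]

theorem mem_translate {x : 𝔼 d} {p : 𝔼 d × X} :
    p ∈ (T.translate x).carrier ↔ (p.1 + x, p.2) ∈ T.carrier := by
  constructor
  · rintro ⟨q, hq, rfl⟩
    simpa using hq
  · intro h
    exact ⟨_, h, by simp⟩

theorem translate_zero (T : LabeledDelone d X) : T.translate 0 = T :=
  LabeledDelone.ext (Set.ext fun p => by simp [mem_translate])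

theorem nonempty_carrier (T : LabeledDelone d X) : T.carrier.Nonempty := by
  obtain ⟨R, -, h⟩ := T.relativelyDense
  obtain ⟨p, hp, -⟩ := h 0
  exact ⟨p, hp⟩

variable {S : Set (𝔼 d × X)} {Y : Type*} {f : 𝔼 d → 𝔼 d} {ℓ : 𝔼 d × X → Y} {K : NNReal}

theorem UniformlyDiscreteWith.image {r : ℝ} (h : UniformlyDiscreteWith S r)
    (hf : AntilipschitzWith K f) :
    UniformlyDiscreteWith ((fun p => (f p.1, ℓ p)) '' S) (r / K) := by
  rintro _ ⟨p, hp, rfl⟩ _ ⟨q, hq, rfl⟩ hpq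
  exact div_le_of_le_mul₀ K.2 dist_nonneg
    ((h p hp q hq (by rintro rfl; exact hpq rfl)).trans (mul_comm _ (K : ℝ) ▸ hf.le_mul_dist _ _))

theorem RelativelyDenseWith.image {R : ℝ} (h : RelativelyDenseWith S R)
    (hf : LipschitzWith K f) (hsurj : Function.Surjective f) :
    RelativelyDenseWith ((fun p => (f p.1, ℓ p)) '' S) (K * R) := by
  intro y
  obtain ⟨x, rfl⟩ := hsurj y
  obtain ⟨p, hp, hpx⟩ := h x
  exact ⟨_, ⟨p, hp, rfl⟩, (hf.dist_le_mul _ _).trans (mul_le_mul_of_nonneg_left hpx K.2)⟩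

theorem UniformlyDiscreteWith.translate {r : ℝ} (h : UniformlyDiscreteWith T.carrier r) (x : 𝔼 d) :
    UniformlyDiscreteWith (T.translate x).carrier r := by
  have himage := h.image (ℓ := Prod.snd) (IsometryEquiv.subRight x).isometry.antilipschitz
  rwa [NNReal.coe_one, div_one] at himage

theorem RelativelyDenseWith.translate {R : ℝ} (h : RelativelyDenseWith T.carrier R) (x : 𝔼 d) :
    RelativelyDenseWith (T.translate x).carrier R := by
  have himage := h.image (ℓ := Prod.snd) (IsometryEquiv.subRight x).isometry.lipschitz
    (IsometryEquiv.subRight x).surjective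
  rwa [NNReal.coe_one, one_mul] at himage

end Carrier

section Limits

variable {d : ℕ} {X : Type u} [MetricSpace X] {T : LabeledDelone d X}

theorem eval_eq_zero {f : C_c(𝔼 d × X, ℝ)} (h : ∀ p ∈ T.carrier, f p = 0) : eval f T = 0 :=
  finsum_mem_eq_zero_of_forall_eq_zero h

theorem le_eval {f : C_c(𝔼 d × X, ℝ)} (hf : ∀ p, 0 ≤ f p) {p : 𝔼 d × X} (hp : p ∈ T.carrier) :
    f p ≤ eval f T := by
  by_cases h0 : f p = 0
  · rw [h0]
    exact finsum_nonneg fun q => finsum_nonneg fun _ => hf q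
  have hfin := T.finite_inter f.hasCompactSupport
  have hsum : eval f T = ∑ q ∈ hfin.toFinset, f q :=
    eval_eq_sum f T hfin.toFinset (fun q hq => (hfin.mem_toFinset.1 hq).1)
      fun q hq hfq => hfin.mem_toFinset.2 ⟨hq, subset_tsupport _ hfq⟩
  rw [hsum]
  exact Finset.single_le_sum (fun q _ => hf q)
    (hfin.mem_toFinset.2 ⟨hp, subset_tsupport _ h0⟩)

variable [CompactSpace X]

/-- The tent function of radius `r` around `q`, a test function that is positive exactly on the
ball of radius `r` around `q`. -/
noncomputable def tent (q : 𝔼 d × X) (r : ℝ) : C_c(𝔼 d × X, ℝ) where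
  toFun p := max 0 (r - dist p q)
  continuous_toFun := by fun_prop
  hasCompactSupport' := by
    refine HasCompactSupport.intro (isCompact_closedBall q r) fun p hp => ?_
    rw [Metric.mem_closedBall, not_le] at hp
    exact max_eq_left (by linarith)

theorem tent_nonneg (q p : 𝔼 d × X) (r : ℝ) : 0 ≤ tent q r p :=
  le_max_left _ _

theorem tent_pos_iff {q p : 𝔼 d × X} {r : ℝ} : 0 < tent q r p ↔ dist p q < r :=
  lt_max_iff.trans (by simp)

theorem eval_tent_pos_iff {q : 𝔼 d × X} {r : ℝ} :
    0 < eval (tent q r) T ↔ ∃ p ∈ T.carrier, dist p q < r := by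
  constructor
  · contrapose!
    intro h
    exact (eval_eq_zero fun p hp => (tent_nonneg q p r).antisymm'
      (not_lt.1 fun hpos => (tent_pos_iff.1 hpos).not_ge (h p hp))).le
  · rintro ⟨p, hp, hpq⟩
    exact (tent_pos_iff.2 hpq).trans_le (le_eval (tent_nonneg q · r) hp)

theorem exists_nearest (T : LabeledDelone d X) (q : 𝔼 d × X) :
    ∃ p ∈ T.carrier, ∀ p' ∈ T.carrier, dist p q ≤ dist p' q := by
  obtain ⟨p₀, hp₀⟩ := T.nonempty_carrier
  obtain ⟨p, hp, hmin⟩ := Set.exists_min_image _ (fun p => dist p q)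
    (T.finite_inter (isCompact_closedBall q (dist p₀ q))) ⟨p₀, hp₀, Metric.mem_closedBall.2 le_rfl⟩
  refine ⟨p, hp.1, fun p' hp' => ?_⟩
  by_cases h : dist p' q ≤ dist p₀ q
  · exact hmin p' ⟨hp', h⟩
  · exact (Metric.mem_closedBall.1 hp.2).trans (not_le.1 h).le

theorem isClosed_carrier (T : LabeledDelone d X) : IsClosed T.carrier := by
  refine isClosed_of_closure_subset fun q hq => ?_
  obtain ⟨p, hp, hmin⟩ := T.exists_nearest q
  suffices h : p = q from h ▸ hp
  refine eq_of_forall_dist_le fun ε hε => ?_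
  obtain ⟨p', hp', hqp'⟩ := Metric.mem_closure_iff.1 hq ε hε
  exact (hmin p' hp').trans (dist_comm q p' ▸ hqp'.le)

variable {Z : Type*} {l : Filter Z} {H : Z → LabeledDelone d X}

theorem eventually_exists_dist_lt (hH : Filter.Tendsto H l (𝓝 T)) {q : 𝔼 d × X}
    (hq : q ∈ T.carrier) {r : ℝ} (hr : 0 < r) : ∀ᶠ z in l, ∃ p ∈ (H z).carrier, dist p q < r := by
  have hpos : 0 < eval (tent q r) T := eval_tent_pos_iff.2 ⟨q, hq, by rwa [dist_self]⟩
  filter_upwards [(((continuous_eval (tent q r)).tendsto T).comp hH).eventually_const_lt hpos]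
    with z hz using eval_tent_pos_iff.1 hz

theorem mem_carrier_of_tendsto [l.NeBot] (hH : Filter.Tendsto H l (𝓝 T)) {q : 𝔼 d × X}
    {g : Z → 𝔼 d × X} (hg : ∀ᶠ z in l, g z ∈ (H z).carrier) (hgq : Filter.Tendsto g l (𝓝 q)) :
    q ∈ T.carrier := by
  refine T.isClosed_carrier.closure_subset (Metric.mem_closure_iff.2 fun r hr => ?_)
  have hle : tent q r q ≤ eval (tent q r) T :=
    le_of_tendsto_of_tendsto (((tent q r).continuous.tendsto q).comp hgq)
      (((continuous_eval (tent q r)).tendsto T).comp hH)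
      (hg.mono fun z hz => le_eval (tent_nonneg q · r) hz)
  have hpos : 0 < tent q r q := tent_pos_iff.2 (by rwa [dist_self])
  simpa only [dist_comm q] using eval_tent_pos_iff.1 (hpos.trans_le hle)

theorem mem_carrier_iff_of_tendsto [l.NeBot] (hH : Filter.Tendsto H l (𝓝 T)) {q : 𝔼 d × X} :
    q ∈ T.carrier ↔
      ∃ g : Z → 𝔼 d × X, (∀ z, g z ∈ (H z).carrier) ∧ Filter.Tendsto g l (𝓝 q) := by
  constructor
  · intro hq
    choose g hg hmin using fun z => (H z).exists_nearest q
    refine ⟨g, hg, Metric.tendsto_nhds.2 fun r hr => ?_⟩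
    filter_upwards [eventually_exists_dist_lt hH hq hr] with z ⟨p, hp, hpq⟩
    exact (hmin z p hp).trans_lt hpq
  · rintro ⟨g, hg, hgq⟩
    exact mem_carrier_of_tendsto hH (.of_forall hg) hgq

theorem isClosed_setOf_mem_carrier (p : 𝔼 d × X) :
    IsClosed {T : LabeledDelone d X | p ∈ T.carrier} :=
  isClosed_iff_ultrafilter.2 fun _ _ hU hpU =>
    mem_carrier_of_tendsto (Filter.tendsto_id.mono_left hU) hpU tendsto_const_nhds

variable {d' : ℕ} {Y : Type*} [MetricSpace Y] [CompactSpace Y]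

theorem continuous_of_carrier_eq_image [TopologicalSpace Z] {G : Z → LabeledDelone d' Y}
    {Φ : Z × (𝔼 d' × Y) → 𝔼 d × X} {K : Set (LabeledDelone d X)} (hG : Continuous G)
    (hΦ : ContinuousOn Φ {w | w.2 ∈ (G w.1).carrier})
    (hproper : ∀ z₀ B, ∃ B', ∀ᶠ z in 𝓝 z₀, ∀ p ∈ (G z).carrier, ‖(Φ (z, p)).1‖ ≤ B → ‖p.1‖ ≤ B')
    (hH : ∀ z, (H z).carrier = (fun p => Φ (z, p)) '' (G z).carrier)
    (hK : IsCompact K) (hHK : ∀ z, H z ∈ K) : Continuous H := by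
  refine continuous_iff_ultrafilter.2 fun z₀ U hU => ?_
  obtain ⟨S, -, hS⟩ := isCompact_iff_ultrafilter_le_nhds'.1 hK (U.map H)
    (Filter.mem_map.2 (Filter.Eventually.of_forall hHK))
  replace hS : Filter.Tendsto H U (𝓝 S) := hS
  have hGU : Filter.Tendsto G U (𝓝 (G z₀)) := (hG.tendsto z₀).mono_left hU
  have hlim : ∀ {g : Z → 𝔼 d' × Y} {p : 𝔼 d' × Y}, (∀ z, g z ∈ (G z).carrier) →
      p ∈ (G z₀).carrier → Filter.Tendsto g U (𝓝 p) →
      Filter.Tendsto (fun z => Φ (z, g z)) U (𝓝 (Φ (z₀, p))) := fun {g p} hg hp hgp =>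
    (hΦ (z₀, p) hp).tendsto.comp (tendsto_nhdsWithin_iff.2
      ⟨(Filter.tendsto_id.mono_right hU).prodMk_nhds hgp, .of_forall hg⟩)
  suffices h : S = H z₀ from h ▸ hS
  refine LabeledDelone.ext (Set.Subset.antisymm (fun q hq => ?_) fun q hq => ?_)
  · obtain ⟨g, hg, hgq⟩ := (mem_carrier_iff_of_tendsto hS).1 hq
    simp only [hH, Set.mem_image] at hg
    choose k hk hkg using hg
    obtain ⟨B', hB'⟩ := hproper z₀ (‖q.1‖ + 1)
    have hbounded : ∀ᶠ z in (U : Filter Z), k z ∈ Metric.closedBall 0 B' ×ˢ Set.univ := by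
      filter_upwards [hU hB', (continuous_fst.norm.tendsto q |>.comp hgq).eventually_le_const
        (lt_add_one ‖q.1‖)] with z hz hgz
      exact ⟨mem_closedBall_zero_iff.2 (hz _ (hk z) ((hkg z).symm ▸ hgz)), trivial⟩
    obtain ⟨p, -, hkp⟩ := isCompact_iff_ultrafilter_le_nhds'.1
      ((isCompact_closedBall 0 B').prod isCompact_univ) (U.map k) hbounded
    have hp : p ∈ (G z₀).carrier := mem_carrier_of_tendsto hGU (.of_forall hk) hkp
    rw [hH]
    refine ⟨p, hp, tendsto_nhds_unique (hlim hk hp hkp) ?_⟩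
    simpa only [hkg] using hgq
  · rw [hH] at hq
    obtain ⟨p, hp, rfl⟩ := hq
    obtain ⟨g, hg, hgp⟩ := (mem_carrier_iff_of_tendsto hGU).1 hp
    exact mem_carrier_of_tendsto hS (.of_forall fun z => hH z ▸ ⟨g z, hg z, rfl⟩) (hlim hg hp hgp)

theorem exists_eval_tent_ne {s : Set (𝔼 d × X)} (hs : Dense s) {T T' : LabeledDelone d X}
    (h : ¬T.carrier ⊆ T'.carrier) :
    ∃ (q : s) (n : ℕ), eval (tent q (1 / (n + 1))) T ≠ eval (tent q (1 / (n + 1))) T' := by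
  obtain ⟨p, hp, hp'⟩ := Set.not_subset.1 h
  obtain ⟨ρ, hρ, hball⟩ := Metric.isOpen_iff.1 T'.isClosed_carrier.isOpen_compl p hp'
  obtain ⟨n, hn⟩ := exists_nat_one_div_lt (half_pos hρ)
  obtain ⟨q, hq, hpq⟩ := hs.exists_dist_lt p (Nat.one_div_pos_of_nat (α := ℝ) (n := n))
  have hpos : 0 < eval (tent q (1 / (n + 1))) T := eval_tent_pos_iff.2 ⟨p, hp, hpq⟩
  refine ⟨⟨q, hq⟩, n, fun heq => ?_⟩
  obtain ⟨p', hp'T, hp'q⟩ := eval_tent_pos_iff.1 (heq ▸ hpos)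
  refine hball (Metric.mem_ball.2 ?_) hp'T
  linarith [dist_triangle_right p' p q]

theorem metrizableSpace_of_isCompact {K : Set (LabeledDelone d X)} (hK : IsCompact K) :
    TopologicalSpace.MetrizableSpace K := by
  have : CompactSpace K := isCompact_iff_compactSpace.1 hK
  obtain ⟨s, hs, hdense⟩ := TopologicalSpace.exists_countable_dense (𝔼 d × X)
  have : Countable s := hs
  have := Encodable.ofCountable (s × ℕ)
  refine Metric.PiNatEmbed.TopologicalSpace.MetrizableSpace.of_countable_separating
    (fun (i : s × ℕ) (T : K) => eval (tent i.1 (1 / (i.2 + 1))) T.1)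
    (fun i => (continuous_eval _).comp continuous_subtype_val) fun T T' hne => ?_
  by_cases h : T.1.carrier ⊆ T'.1.carrier
  · have h' : ¬T'.1.carrier ⊆ T.1.carrier := fun h' =>
      hne (Subtype.ext (LabeledDelone.ext (h.antisymm h')))
    obtain ⟨q, n, hqn⟩ := exists_eval_tent_ne hdense h'
    exact ⟨(q, n), hqn.symm⟩
  · obtain ⟨q, n, hqn⟩ := exists_eval_tent_ne hdense h
    exact ⟨(q, n), hqn⟩

end Limits

end LabeledDelone

namespace TilingSpace

open LabeledDelone

section Translation

variable {d : ℕ} {X : Type u} [MetricSpace X] (Ω : TilingSpace d X)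

theorem translate_translate (T : Ω) (x y : 𝔼 d) :
    Ω.translate (Ω.translate T x) y = Ω.translate T (x + y) :=
  Subtype.ext (T.1.translate_translate x y)

theorem translate_zero (T : Ω) : Ω.translate T 0 = T :=
  Subtype.ext T.1.translate_zero

instance : Nonempty Ω := by
  obtain ⟨T, hT⟩ := Ω.exists_hull_eq
  exact ⟨⟨T, hT ▸ subset_closure ⟨0, T.translate_zero⟩⟩⟩

theorem dense_range_translate (T : Ω) : Dense (Set.range (Ω.translate T)) := by
  intro S
  rw [closure_subtype, ← Set.range_comp]
  exact Ω.minimal T.1 T.2 S.2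

/-- The canonical transversal of `Ω`: the tilings that have a point at the origin. -/
def transversal : Set Ω := {T | 0 ∈ T.1.points}

variable {Ω}

theorem translate_mem_transversal_iff {T : Ω} {x : 𝔼 d} :
    Ω.translate T x ∈ Ω.transversal ↔ x ∈ T.1.points := by
  simp only [transversal, Set.mem_ofPred_eq, mem_points]
  simp only [translate, mem_translate, zero_add]

variable [CompactSpace X]

variable (Ω) in
theorem exists_uniform : ∃ r R : ℝ, 0 < r ∧ 0 < R ∧ ∀ T : Ω,
    UniformlyDiscreteWith T.1.carrier r ∧ RelativelyDenseWith T.1.carrier R := by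
  obtain ⟨T, hT⟩ := Ω.exists_hull_eq
  obtain ⟨r, hr, hrT⟩ := T.uniformlyDiscrete
  obtain ⟨R, hR, hRT⟩ := T.relativelyDense
  refine ⟨r, R, hr, hR, fun S => ?_⟩
  have hclosed := (isCompact_setOf (d := d) (X := X) r R hr hR).isClosed
  refine closure_minimal (s := Set.range T.translate) ?_ hclosed (hT.superset S.2)
  rintro _ ⟨x, rfl⟩
  exact ⟨UniformlyDiscreteWith.translate hrT x, RelativelyDenseWith.translate hRT x⟩

theorem isCompact_carrier : IsCompact Ω.carrier := isCompact_iff_compactSpace.2 inferInstance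

instance : TopologicalSpace.MetrizableSpace Ω := metrizableSpace_of_isCompact isCompact_carrier

variable (Ω) in
theorem continuous_translate_uncurry :
    Continuous fun z : Ω × 𝔼 d => Ω.translate z.1 z.2 := by
  refine .subtype_mk (continuous_of_carrier_eq_image (G := fun z : Ω × 𝔼 d => z.1.1)
    (Φ := fun w => (w.2.1 - w.1.2, w.2.2)) (by fun_prop) (by fun_prop) (fun z₀ B => ?_)
    (fun z => rfl) isCompact_carrier fun z => (Ω.translate z.1 z.2).2) _
  refine ⟨B + (‖z₀.2‖ + 1), ?_⟩
  filter_upwards [(continuous_snd.norm.tendsto z₀).eventually_le_const (lt_add_one ‖z₀.2‖)]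
    with z hz p _ hp
  linarith [norm_le_norm_sub_add p.1 z.2]

/-- The translation action as a flow. -/
def translationFlow (Ω : TilingSpace d X) : Flow (𝔼 d) Ω where
  toFun x T := Ω.translate T x
  cont' := Ω.continuous_translate_uncurry.comp continuous_swap
  map_add' x y T := by rw [translate_translate, add_comm]
  map_zero' := Ω.translate_zero

end Translation

section Cocycle

variable {d : ℕ} {X : Type u} [MetricSpace X] {Ω : TilingSpace d X} (α : Ω.weakCocycles) (T : Ω)

theorem cocycle_add (x y : 𝔼 d) : α.1 (T, x + y) = α.1 (T, x) + α.1 (Ω.translate T x, y) :=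
  (α.2 T x y).symm

theorem cocycle_translate (x y : 𝔼 d) :
    α.1 (Ω.translate T x, y) = α.1 (T, x + y) - α.1 (T, x) := by
  rw [cocycle_add, add_sub_cancel_left]

theorem cocycle_sub (x y : 𝔼 d) :
    α.1 (Ω.translate T x, y - x) = α.1 (T, y) - α.1 (T, x) := by
  rw [cocycle_translate, add_sub_cancel]

theorem cocycle_zero : α.1 (T, 0) = 0 := by
  simpa [translate_zero] using cocycle_translate α T 0 0

/-- All the maps `α(T, ·)` are bi-Lipschitz bijections of `ℝ^d`, with constants `M` and `K` for
the map and for its inverse that do not depend on `T`. -/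
structure IsBiLipschitz (K M : NNReal) : Prop where
  pos_left : 0 < K
  pos_right : 0 < M
  antilipschitzWith : ∀ T, AntilipschitzWith K fun x => α.1 (T, x)
  lipschitzWith : ∀ T, LipschitzWith M fun x => α.1 (T, x)
  surjective : ∀ T, Function.Surjective fun x => α.1 (T, x)

variable {α} {K M : NNReal} (hα : IsBiLipschitz α K M)

include hα

theorem IsBiLipschitz.isHomeomorph : IsHomeomorph fun x => α.1 (T, x) :=
  isHomeomorph_iff_isEmbedding_surjective.2
    ⟨((hα.antilipschitzWith T).isUniformEmbedding
      (hα.lipschitzWith T).uniformContinuous).isEmbedding, hα.surjective T⟩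

theorem IsBiLipschitz.norm_le (v : 𝔼 d) : ‖v‖ ≤ K * ‖α.1 (T, v)‖ := by
  simpa [cocycle_zero] using (hα.antilipschitzWith T).le_mul_dist v 0

theorem IsBiLipschitz.eq_of_translate_eq {T T' : Ω} {x y : 𝔼 d}
    (h : Ω.translate T x = Ω.translate T' y) (hxy : α.1 (T, x) = α.1 (T', y)) : T = T' := by
  have hinv : α.1 (Ω.translate T x, -x) = α.1 (Ω.translate T x, -y) := by
    conv_rhs => rw [h]
    rw [cocycle_translate, cocycle_translate, hxy, add_neg_cancel, add_neg_cancel, cocycle_zero,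
      cocycle_zero]
  obtain rfl : x = y := neg_injective ((hα.antilipschitzWith _).injective hinv)
  simpa only [translate_translate, add_neg_cancel, translate_zero] using
    congrArg (Ω.translate · (-x)) h

end Cocycle

section Deformation

variable {d : ℕ} {X Y : Type u} [MetricSpace X] {Ω : TilingSpace d X}
  {α : Ω.weakCocycles} {K M : NNReal}

/-- The image of `T` under `α(T, ·)`, where the image of the point `x` of `T` is labeled by
`L(T - x)`. The labels of `T` are forgotten, so `L` has to remember what is needed of them. -/
def deform (hα : IsBiLipschitz α K M) (L : Ω → Y) (T : Ω) : LabeledDelone d Y where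
  carrier := (fun p => (α.1 (T, p.1), L (Ω.translate T p.1))) '' T.1.carrier
  uniformlyDiscrete := by
    obtain ⟨r, hr, h⟩ := T.1.uniformlyDiscrete
    exact ⟨r / K, div_pos hr hα.pos_left, UniformlyDiscreteWith.image h (hα.antilipschitzWith T)⟩
  relativelyDense := by
    obtain ⟨R, hR, h⟩ := T.1.relativelyDense
    exact ⟨M * R, mul_pos hα.pos_right hR,
      RelativelyDenseWith.image h (hα.lipschitzWith T) (hα.surjective T)⟩

variable {hα : IsBiLipschitz α K M} {L : Ω → Y} {T T' : Ω}

theorem mem_deform {q : 𝔼 d × Y} : q ∈ (deform hα L T).carrier ↔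
    ∃ x ∈ T.1.points, (α.1 (T, x), L (Ω.translate T x)) = q := by
  simp only [deform, points, Set.mem_image, exists_exists_and_eq_and]

theorem points_deform (hα : IsBiLipschitz α K M) (L : Ω → Y) (T : Ω) :
    (deform hα L T).points = (fun x => α.1 (T, x)) '' T.1.points := by
  simp only [points, deform, Set.image_image]

theorem deform_translate (hα : IsBiLipschitz α K M) (L : Ω → Y) (T : Ω) (x : 𝔼 d) :
    deform hα L (Ω.translate T x) = (deform hα L T).translate (α.1 (T, x)) := by
  refine LabeledDelone.ext (((Set.image_image _ _ _).trans ?_).trans (Set.image_image _ _ _).symm)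
  refine Set.image_congr fun p _ => ?_
  rw [cocycle_sub, translate_translate, add_sub_cancel]

theorem exists_of_deform_eq (h : deform hα L T = deform hα L T') {x : 𝔼 d} (hx : x ∈ T.1.points) :
    ∃ y ∈ T'.1.points, α.1 (T', y) = α.1 (T, x) ∧
      L (Ω.translate T' y) = L (Ω.translate T x) := by
  obtain ⟨y, hy, hyx⟩ := mem_deform.1 (h ▸ mem_deform.2 ⟨x, hx, rfl⟩)
  exact ⟨y, hy, Prod.ext_iff.1 hyx⟩

theorem deform_injective (hα : IsBiLipschitz α K M) (hL : Function.Injective L) :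
    Function.Injective (deform hα L) := by
  intro T T' h
  obtain ⟨p, hp⟩ := T.1.nonempty_carrier
  obtain ⟨y, -, hy, hyL⟩ := exists_of_deform_eq h (x := p.1) ⟨p, hp, rfl⟩
  exact hα.eq_of_translate_eq (hL hyL.symm) hy.symm

variable [MetricSpace Y] [CompactSpace X] [CompactSpace Y]

theorem continuous_deform (hα : IsBiLipschitz α K M) (hL : ContinuousOn L Ω.transversal) :
    Continuous (deform hα L) := by
  obtain ⟨r, R, hr, hR, hΩ⟩ := Ω.exists_uniform
  have hlabel : ContinuousOn (fun w : Ω × (𝔼 d × X) => L (Ω.translate w.1 w.2.1))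
      {w | w.2 ∈ w.1.1.carrier} :=
    hL.comp (Ω.continuous_translate_uncurry.comp
      (by fun_prop : Continuous fun w : Ω × (𝔼 d × X) => (w.1, w.2.1))).continuousOn
      fun w hw => translate_mem_transversal_iff.2 ⟨w.2, hw, rfl⟩
  refine continuous_of_carrier_eq_image
    (Φ := fun w => (α.1 (w.1, w.2.1), L (Ω.translate w.1 w.2.1)))
    continuous_subtype_val (ContinuousOn.prodMk (by fun_prop) hlabel)
    (fun T₀ B => ⟨K * B, .of_forall fun T p _ hp =>
      (hα.norm_le T p.1).trans (mul_le_mul_of_nonneg_left hp K.2)⟩) (fun T => rfl)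
    (isCompact_setOf (r / K) (M * R) (div_pos hr hα.pos_left) (mul_pos hα.pos_right hR))
    fun T => ⟨(hΩ T).1.image (hα.antilipschitzWith T),
      (hΩ T).2.image (hα.lipschitzWith T) (hα.surjective T)⟩

theorem hull_deform (hα : IsBiLipschitz α K M) (hL : ContinuousOn L Ω.transversal) (T : Ω) :
    (deform hα L T).hull = Set.range (deform hα L) := by
  have hcont := continuous_deform hα hL
  have horbit : Set.range (deform hα L T).translate = deform hα L '' Set.range (Ω.translate T) := by
    rw [← (hα.surjective T).range_comp, ← Set.range_comp]
    exact congrArg Set.range (funext fun x => (deform_translate hα L T x).symm)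
  rw [hull, horbit]
  exact (closure_minimal (Set.image_subset_range _ _) (isCompact_range hcont).isClosed).antisymm
    (hcont.range_subset_closure_image_dense (Ω.dense_range_translate T))

theorem exists_homeomorph_deform (hα : IsBiLipschitz α K M) (hL : ContinuousOn L Ω.transversal)
    (hinj : Function.Injective (deform hα L)) :
    ∃ (Ω' : TilingSpace d Y) (h : Ω ≃ₜ Ω'), (∀ T, (h T).1 = deform hα L T) ∧
      IsShapeDeformation Ω Ω' α h ∧ (Ω.IsAperiodic → Ω'.IsAperiodic) := by
  let Ω' : TilingSpace d Y :=
    { carrier := Set.range (deform hα L)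
      exists_hull_eq := ⟨_, hull_deform hα hL (Classical.arbitrary Ω)⟩
      minimal := by
        rintro _ ⟨T, rfl⟩
        exact (hull_deform hα hL T).superset }
  let h : Ω ≃ₜ Ω' := ((continuous_deform hα hL).isClosedEmbedding hinj).isEmbedding.toHomeomorph
  have hmap : ∀ T x, h (Ω.translate T x) = Ω'.translate (h T) (α.1 (T, x)) := fun T x =>
    Subtype.ext (deform_translate hα L T x)
  refine ⟨Ω', h, fun T => rfl,
    ⟨fun T => hα.isHomeomorph T, fun T => (points_deform hα L T).symm, hmap⟩, fun hap S x hx => ?_⟩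
  obtain ⟨T, rfl⟩ := h.surjective S
  obtain ⟨y, rfl⟩ := hα.surjective T x
  rw [hap T y (h.injective ((hmap T y).trans hx))]
  exact cocycle_zero α T

theorem IsBiLipschitz.exists_homeomorph (hα : IsBiLipschitz α K M) :
    ∃ (Y : Type u) (_ : MetricSpace Y) (_ : CompactSpace Y) (Ω' : TilingSpace d Y) (h : Ω ≃ₜ Ω'),
      IsShapeDeformation Ω Ω' α h ∧ (Ω.IsAperiodic → Ω'.IsAperiodic) := by
  let := TopologicalSpace.metrizableSpaceMetric Ω
  obtain ⟨Ω', h, -, hh⟩ := exists_homeomorph_deform hα (L := id) continuousOn_id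
    (deform_injective hα Function.injective_id)
  exact ⟨Ω, inferInstance, inferInstance, Ω', h, hh⟩

end Deformation

end TilingSpace

/-- A Lipschitz probability density on `V` that vanishes outside the unit ball. -/
structure AveragingKernel (V : Type*) [NormedAddCommGroup V] [MeasureSpace V] where
  density : V → ℝ
  lipConst : NNReal
  nonneg : ∀ z, 0 ≤ density z
  lipschitzWith : LipschitzWith lipConst density
  density_eq_zero : ∀ z, 1 < ‖z‖ → density z = 0
  integral_density : ∫ z, density z = 1

namespace AveragingKernel

variable {V : Type*} [NormedAddCommGroup V] [MeasureSpace V]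

/-- The probability measure on the unit ball with the given density. -/
noncomputable def measure (φ : AveragingKernel V) : Measure V :=
  volume.withDensity fun z => ENNReal.ofReal (φ.density z)

theorem hasCompactSupport [NormedSpace ℝ V] [FiniteDimensional ℝ V] (φ : AveragingKernel V) :
    HasCompactSupport φ.density :=
  HasCompactSupport.intro (isCompact_closedBall 0 1) fun z hz =>
    φ.density_eq_zero z (by simpa using hz)

variable [BorelSpace V]

theorem integral_measure {F : Type*} [NormedAddCommGroup F] [NormedSpace ℝ F]
    (φ : AveragingKernel V) (G : V → F) : ∫ z, G z ∂φ.measure = ∫ z, φ.density z • G z := by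
  rw [measure, integral_withDensity_eq_integral_toReal_smul
    φ.lipschitzWith.continuous.measurable.ennreal_ofReal (by simp)]
  simp only [ENNReal.toReal_ofReal (φ.nonneg _)]

theorem ae_norm_le_one (φ : AveragingKernel V) : ∀ᵐ z ∂φ.measure, ‖z‖ ≤ 1 := by
  rw [measure, ae_withDensity_iff φ.lipschitzWith.continuous.measurable.ennreal_ofReal]
  refine .of_forall fun z hz => not_lt.1 fun hz' => hz ?_
  rw [φ.density_eq_zero z hz', ENNReal.ofReal_zero]

theorem restrict_measure (φ : AveragingKernel V) :
    φ.measure.restrict (Metric.closedBall 0 1) = φ.measure :=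
  Measure.restrict_eq_self_of_ae_mem (by simpa using φ.ae_norm_le_one)

variable [NormedSpace ℝ V] [FiniteDimensional ℝ V] [(volume : Measure V).IsAddHaarMeasure]

instance : Nonempty (AveragingKernel V) := by
  let f : ContDiffBump (0 : V) := ⟨1 / 2, 1, by norm_num, by norm_num⟩
  obtain ⟨κ, hκ⟩ := ContDiff.lipschitzWith_of_hasCompactSupport (𝕂 := ℝ) (n := 1)
    (f.hasCompactSupport_normed (μ := volume)) (f.contDiff_normed (n := 1)) one_ne_zero
  refine ⟨f.normed volume, κ, f.nonneg_normed, hκ, fun z hz => ?_, f.integral_normed⟩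
  refine Function.notMem_support.1 fun h => ?_
  rw [f.support_normed_eq, mem_ball_zero_iff] at h
  exact h.not_gt hz

variable (φ : AveragingKernel V)

theorem integrable_density : Integrable φ.density :=
  φ.lipschitzWith.continuous.integrable_of_hasCompactSupport φ.hasCompactSupport

instance : IsProbabilityMeasure φ.measure := by
  refine ⟨?_⟩
  rw [measure, withDensity_apply _ MeasurableSet.univ, Measure.restrict_univ,
    ← ofReal_integral_eq_lintegral_ofReal φ.integrable_density (.of_forall φ.nonneg),
    φ.integral_density, ENNReal.ofReal_one]

variable {F : Type*} [NormedAddCommGroup F] {G : V → F}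

theorem integrable_of_continuous (hG : Continuous G) : Integrable G φ.measure := by
  rw [← φ.restrict_measure]
  exact hG.continuousOn.integrableOn_compact (isCompact_closedBall 0 1)

variable [NormedSpace ℝ F]

theorem norm_integral_shift_le (hG : Continuous G) {ε : ℝ} (hε : ∀ w, ‖w‖ ≤ 2 → ‖G w‖ ≤ ε)
    {v : V} (hv : ‖v‖ ≤ 1) :
    ‖∫ z, (G (z + v) - G z) ∂φ.measure‖ ≤
      φ.lipConst * ‖v‖ * ε * volume.real (Metric.closedBall (0 : V) 2) := by
  have hint : ∀ {H : V → F}, Continuous H → Integrable fun z => φ.density z • H z := fun hH =>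
    (φ.lipschitzWith.continuous.smul hH).integrable_of_hasCompactSupport
      φ.hasCompactSupport.smul_right
  have hint_shift := hint (H := fun z => G (z + v)) (by fun_prop)
  -- the shift is moved from `G` to the density, which is Lipschitz
  have hshift : ∫ z, (G (z + v) - G z) ∂φ.measure =
      ∫ z, (φ.density (z - v) - φ.density z) • G z := by
    simp only [integral_measure, smul_sub, sub_smul]
    rw [integral_sub hint_shift (hint hG), integral_sub (by simpa using hint_shift.comp_sub_right v)
      (hint hG), ← integral_sub_right_eq_self (fun z => φ.density z • G (z + v)) v]
    simp only [sub_add_cancel]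
  have hsupp : ∀ z ∉ Metric.closedBall 0 2, (φ.density (z - v) - φ.density z) • G z = 0 := by
    intro z hz
    rw [mem_closedBall_zero_iff, not_le] at hz
    rw [φ.density_eq_zero z (by linarith), φ.density_eq_zero (z - v), sub_zero, zero_smul]
    linarith [norm_sub_norm_le z v]
  rw [hshift, ← setIntegral_eq_integral_of_forall_compl_eq_zero hsupp]
  refine norm_setIntegral_le_of_norm_le_const measure_closedBall_lt_top fun z hz => ?_
  have hlip := φ.lipschitzWith.norm_sub_le (z - v) z
  rw [sub_sub_cancel_left, norm_neg] at hlip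
  rw [norm_smul]
  exact mul_le_mul hlip (hε z (by simpa using hz)) (norm_nonneg _) (by positivity)

end AveragingKernel

section UniqueErgodicity

variable {V : Type*} [NormedAddCommGroup V] [NormedSpace ℝ V] {Z : Type*} [TopologicalSpace Z]

theorem continuous_orbit_smul (ϕ : Flow V Z) (t : ℝ) (x : Z) :
    Continuous fun z : V => ϕ (t • z) x :=
  ϕ.continuous (by fun_prop) continuous_const

variable [MeasureSpace V] [BorelSpace V] [FiniteDimensional ℝ V]
  [(volume : Measure V).IsAddHaarMeasure] [MeasurableSpace Z] [BorelSpace Z]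

/-- The image of an averaging kernel, dilated by the factor `q.1`, on the orbit of `q.2`. -/
noncomputable def orbitMeasure (φ : AveragingKernel V) (ϕ : Flow V Z) (q : ℝ × Z) :
    ProbabilityMeasure Z :=
  ⟨φ.measure.map fun z => ϕ (q.1 • z) q.2,
    Measure.isProbabilityMeasure_map (continuous_orbit_smul ϕ q.1 q.2).measurable.aemeasurable⟩

variable (φ : AveragingKernel V) (ϕ : Flow V Z)

theorem integral_orbitMeasure [TopologicalSpace.PseudoMetrizableSpace Z] {f : Z → ℝ}
    (hf : Continuous f) (q : ℝ × Z) :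
    ∫ y, f y ∂(orbitMeasure φ ϕ q : Measure Z) = ∫ z, f (ϕ (q.1 • z) q.2) ∂φ.measure :=
  integral_map (continuous_orbit_smul ϕ q.1 q.2).measurable.aemeasurable hf.aestronglyMeasurable

variable [CompactSpace Z] [TopologicalSpace.MetrizableSpace Z]

theorem tendsto_integral_orbitMeasure_comp_sub (f : C(Z, ℝ)) (v : V) :
    Filter.Tendsto (fun q => ∫ y, f (ϕ v y) ∂(orbitMeasure φ ϕ q : Measure Z) -
      ∫ y, f y ∂(orbitMeasure φ ϕ q : Measure Z)) (Filter.atTop ×ˢ ⊤) (𝓝 0) := by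
  set W := volume.real (Metric.closedBall (0 : V) 2)
  have hsmall : Filter.Tendsto (fun q : ℝ × Z => ‖q.1⁻¹ • v‖) (Filter.atTop ×ˢ ⊤) (𝓝 0) := by
    simpa using (((tendsto_inv_atTop_zero (𝕜 := ℝ)).comp Filter.tendsto_fst).smul_const v).norm
  have hbound : Filter.Tendsto (fun q : ℝ × Z => φ.lipConst * ‖q.1⁻¹ • v‖ * ‖f‖ * W)
      (Filter.atTop ×ˢ ⊤) (𝓝 0) := by
    simpa using ((hsmall.const_mul (φ.lipConst : ℝ)).mul_const ‖f‖).mul_const W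
  refine squeeze_zero_norm' ?_ hbound
  filter_upwards [hsmall.eventually_le_const one_pos,
    Filter.tendsto_fst.eventually (Filter.eventually_ne_atTop (0 : ℝ))] with q hq hq0
  have horbit : Continuous fun z => f (ϕ (q.1 • z) q.2) :=
    f.continuous.comp (continuous_orbit_smul ϕ q.1 q.2)
  have horbit_shift : Continuous fun z => f (ϕ (q.1 • (z + q.1⁻¹ • v)) q.2) :=
    horbit.comp (continuous_add_const _)
  have hshift : ∀ z, ϕ v (ϕ (q.1 • z) q.2) = ϕ (q.1 • (z + q.1⁻¹ • v)) q.2 := fun z => by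
    rw [smul_add, smul_inv_smul₀ hq0, add_comm, ϕ.map_add]
  rw [integral_orbitMeasure φ ϕ (by fun_prop), integral_orbitMeasure φ ϕ f.continuous]
  simp only [hshift]
  rw [← integral_sub (φ.integrable_of_continuous horbit_shift)
    (φ.integrable_of_continuous horbit)]
  exact φ.norm_integral_shift_le horbit (fun w _ => f.norm_coe_le_norm _) hq

theorem tendsto_orbitMeasure {μ : ProbabilityMeasure Z}
    (hμ : ∀ ρ : ProbabilityMeasure Z, (∀ v, (ρ : Measure Z).map (ϕ v) = ρ) → ρ = μ) :
    Filter.Tendsto (orbitMeasure φ ϕ) (Filter.atTop ×ˢ ⊤) (𝓝 μ) := by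
  refine tendsto_nhds_of_unique_mapClusterPt fun ρ hρ => hμ ρ fun v => ?_
  obtain ⟨U, hU, hUρ⟩ := mapClusterPt_iff_ultrafilter.1 hρ
  have hϕ : Continuous (ϕ v) := by fun_prop
  have hlim := ProbabilityMeasure.tendsto_iff_forall_integral_tendsto.1 hUρ
  have := Measure.isProbabilityMeasure_map (μ := (ρ : Measure Z)) hϕ.measurable.aemeasurable
  refine ext_of_forall_integral_eq_of_IsFiniteMeasure fun f => ?_
  rw [integral_map hϕ.measurable.aemeasurable f.continuous.aestronglyMeasurable]
  exact sub_eq_zero.1 (tendsto_nhds_unique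
    ((hlim (f.compContinuous ⟨ϕ v, hϕ⟩)).sub (hlim f))
    ((tendsto_integral_orbitMeasure_comp_sub φ ϕ f.toContinuousMap v).mono_left hU))

end UniqueErgodicity

theorem exists_nsmul_eq_of_norm_lt {V : Type*} [NormedAddCommGroup V] [NormedSpace ℝ V] {δ : ℝ}
    (hδ : 0 < δ) (v : V) : ∃ (n : ℕ) (w : V), n • w = v ∧ n * ‖w‖ = ‖v‖ ∧ ‖w‖ < δ := by
  obtain ⟨n, hn⟩ := exists_nat_gt (‖v‖ / δ)
  have hn0 : (0 : ℝ) < n := lt_of_le_of_lt (by positivity) hn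
  have hw : ‖(n : ℝ)⁻¹ • v‖ = ‖v‖ / n := by
    rw [norm_smul, norm_inv, Real.norm_of_nonneg hn0.le, inv_mul_eq_div]
  refine ⟨n, (n : ℝ)⁻¹ • v, ?_, ?_, ?_⟩
  · rw [← Nat.cast_smul_eq_nsmul ℝ, smul_inv_smul₀ hn0.ne']
  · rw [hw, mul_div_cancel₀ _ hn0.ne']
  · rwa [hw, div_lt_comm₀ hn0 hδ]

namespace TilingSpace

variable {d : ℕ} {X : Type u} [MetricSpace X] {Ω : TilingSpace d X}

section LinearApproximation

variable (Ω) in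
/-- A linear map, as a cocycle independent of the tiling. -/
def linearCocycle (A : 𝔼 d →L[ℝ] 𝔼 d) : Ω.weakCocycles :=
  ⟨⟨fun z => A z.2, by fun_prop⟩, fun _ x y => (A.map_add x y).symm⟩

theorem sub_linearCocycle_apply (α : Ω.weakCocycles) (A : 𝔼 d →L[ℝ] 𝔼 d) (T : Ω) (v : 𝔼 d) :
    (α - linearCocycle Ω A).1 (T, v) = α.1 (T, v) - A v := rfl

theorem norm_cocycle_nsmul_le (γ : Ω.weakCocycles) {w : 𝔼 d} {C : ℝ}
    (hC : ∀ T, ‖γ.1 (T, w)‖ ≤ C) (n : ℕ) (T : Ω) : ‖γ.1 (T, n • w)‖ ≤ n * C := by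
  induction n with
  | zero => simp [cocycle_zero]
  | succ n ih =>
    rw [succ_nsmul, cocycle_add, Nat.cast_succ, add_one_mul]
    exact norm_add_le_of_le ih (hC _)

theorem norm_cocycle_le_of_forall_norm_le_one (γ : Ω.weakCocycles) {c : ℝ}
    (hc : ∀ T v, ‖v‖ ≤ 1 → ‖γ.1 (T, v)‖ ≤ c * ‖v‖) (T : Ω) (v : 𝔼 d) :
    ‖γ.1 (T, v)‖ ≤ c * ‖v‖ := by
  obtain ⟨n, w, rfl, hnorm, hw⟩ := exists_nsmul_eq_of_norm_lt one_pos v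
  rw [← hnorm, mul_left_comm]
  exact norm_cocycle_nsmul_le γ (fun T => hc T w hw.le) n T

theorem exists_isBiLipschitz_of_norm_sub_le (α : Ω.weakCocycles) (A : 𝔼 d ≃L[ℝ] 𝔼 d)
    {c : NNReal} (hc : ‖(A.symm : 𝔼 d →L[ℝ] 𝔼 d)‖₊ * c < 1)
    (h : ∀ T v, ‖α.1 (T, v) - A v‖ ≤ c * ‖v‖) : ∃ K M, IsBiLipschitz α K M := by
  set N := ‖(A.symm : 𝔼 d →L[ℝ] 𝔼 d)‖₊
  have happrox : ∀ T,
      ApproximatesLinearOn (fun x => α.1 (T, x)) (A : 𝔼 d →L[ℝ] 𝔼 d) Set.univ c := by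
    intro T x _ y _
    rw [← cocycle_sub]
    exact h _ _
  have hN : Subsingleton (𝔼 d) ∨ c < N⁻¹ :=
    A.subsingleton_or_nnnorm_symm_pos.imp_right fun hN_pos => by
      rwa [← one_div, lt_div_iff₀' hN_pos]
  refine ⟨(N⁻¹ - c)⁻¹ + 1, ‖(A : 𝔼 d →L[ℝ] 𝔼 d)‖₊ + c + 1, by positivity, by positivity,
    fun T => ?_, fun T => ?_, fun T => (happrox T).surjective hN⟩
  · have hanti := (happrox T).antilipschitz hN
    exact fun x y => (hanti ⟨x, trivial⟩ ⟨y, trivial⟩).trans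
      (mul_le_mul_left (ENNReal.coe_le_coe.2 le_self_add) _)
  · exact (lipschitzOnWith_univ.1 (lipschitzOnWith_iff_restrict.2 (happrox T).lipschitz)).weaken
      le_self_add

theorem eventually_forall_norm_cocycle_sub_lt [CompactSpace Ω] (α : Ω.weakCocycles) (v : 𝔼 d)
    {ε : ℝ} (hε : 0 < ε) :
    ∀ᶠ w in 𝓝 v, ∀ T, ‖α.1 (T, w) - α.1 (T, v)‖ < ε := by
  have hcont : Continuous fun z : 𝔼 d × Ω => ‖α.1 (z.2, z.1) - α.1 (z.2, v)‖ := by fun_prop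
  have hlocal : ∀ T ∈ Set.univ, ∀ᶠ z : 𝔼 d × Ω in 𝓝 (v, T),
      ‖α.1 (z.2, z.1) - α.1 (z.2, v)‖ < ε := fun T _ =>
    (hcont.tendsto (v, T)).eventually_lt_const (by simpa using hε)
  simpa using isCompact_univ.eventually_forall_of_forall_eventually
    (P := fun w T => ‖α.1 (T, w) - α.1 (T, v)‖ < ε) hlocal

end LinearApproximation

section Mollification

variable [CompactSpace X]

/-- The coboundary of a continuous function, as a weak cocycle. -/
noncomputable def coboundary (s : C(Ω, 𝔼 d)) : Ω.weakCocycles :=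
  ⟨⟨fun z => s (Ω.translate z.1 z.2) - s z.1,
    (s.continuous.comp Ω.continuous_translate_uncurry).sub (s.continuous.comp continuous_fst)⟩, by
    intro T x y
    simp only [ContinuousMap.coe_mk, translate_translate]
    abel⟩

theorem coboundary_apply (s : C(Ω, 𝔼 d)) (T : Ω) (v : 𝔼 d) :
    (coboundary s).1 (T, v) = s (Ω.translate T v) - s T := rfl

variable (φ : AveragingKernel (𝔼 d)) (t : ℝ) (α : Ω.weakCocycles)

/-- The average of `α(T, x)` over the `x` in the ball of radius `t`, weighted by `φ`, as a function
of `T`. -/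
noncomputable def primitive : C(Ω, 𝔼 d) where
  toFun T := ∫ z, α.1 (T, t • z) ∂φ.measure
  continuous_toFun := by
    simpa only [φ.restrict_measure] using
      continuous_parametric_integral_of_continuous (μ := φ.measure)
        (f := fun (T : Ω) z => α.1 (T, t • z)) (by unfold Function.uncurry; fun_prop)
        (isCompact_closedBall 0 1)

/-- The cocycle `(T, v) ↦ α(T - x, v)` averaged over the `x` in the ball of radius `t`, weighted by
`φ`. It is defined as `α` plus a coboundary because this makes it evident that the class does not
change; see `mollify_apply` for the average. -/
noncomputable def mollify : Ω.weakCocycles :=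
  α + coboundary (primitive φ t α)

theorem mk_mollify : (QuotientAddGroup.mk (mollify φ t α) : Ω.H1w) = QuotientAddGroup.mk α := by
  symm
  rw [QuotientAddGroup.eq]
  refine ⟨primitive φ t α, fun T v => ?_⟩
  rw [mollify, neg_add_cancel_left, coboundary_apply]

theorem integrable_cocycle_smul (T : Ω) : Integrable (fun z => α.1 (T, t • z)) φ.measure :=
  φ.integrable_of_continuous (by fun_prop)

theorem integrable_cocycle_translate_smul (T : Ω) (v : 𝔼 d) :
    Integrable (fun z => α.1 (Ω.translate T (t • z), v)) φ.measure :=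
  φ.integrable_of_continuous (by simp only [cocycle_translate]; fun_prop)

theorem mollify_apply (T : Ω) (v : 𝔼 d) :
    (mollify φ t α).1 (T, v) = ∫ z, α.1 (Ω.translate T (t • z), v) ∂φ.measure := by
  have hshift : ∀ z, α.1 (Ω.translate T (t • z), v) =
      α.1 (T, v) + (α.1 (Ω.translate T v, t • z) - α.1 (T, t • z)) := fun z => by
    rw [cocycle_translate, cocycle_translate, add_comm v]
    abel
  have hint := fun S => integrable_cocycle_smul φ t α S
  simp only [hshift]
  rw [integral_add (integrable_const _) ((hint _).sub' (hint _)), integral_sub (hint _) (hint _),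
    integral_const, probReal_univ, one_smul]
  rfl

theorem mollify_sub_linearCocycle_apply (A : 𝔼 d →L[ℝ] 𝔼 d) (T : Ω) (v : 𝔼 d) :
    (mollify φ t (α - linearCocycle Ω A)).1 (T, v) = (mollify φ t α).1 (T, v) - A v := by
  simp only [mollify_apply, sub_linearCocycle_apply]
  rw [integral_sub (integrable_cocycle_translate_smul φ t α T v) (integrable_const _),
    integral_const, probReal_univ, one_smul]

theorem norm_mollify_sub_mollify_le {v w : 𝔼 d} {ε : ℝ}
    (h : ∀ T, ‖α.1 (T, w) - α.1 (T, v)‖ ≤ ε) (T : Ω) :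
    ‖(mollify φ t α).1 (T, w) - (mollify φ t α).1 (T, v)‖ ≤ ε := by
  rw [mollify_apply, mollify_apply, ← integral_sub (integrable_cocycle_translate_smul φ t α T w)
    (integrable_cocycle_translate_smul φ t α T v)]
  simpa using norm_integral_le_of_norm_le_const (μ := φ.measure)
    (.of_forall fun z => h (Ω.translate T (t • z)))

theorem norm_mollify_one_le {ε : ℝ} (hε : ∀ T v, ‖v‖ ≤ 2 → ‖α.1 (T, v)‖ ≤ ε) (T : Ω) (v : 𝔼 d) :
    ‖(mollify φ 1 α).1 (T, v)‖ ≤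
      φ.lipConst * ε * volume.real (Metric.closedBall (0 : 𝔼 d) 2) * ‖v‖ := by
  refine norm_cocycle_le_of_forall_norm_le_one _ (fun T v hv => ?_) T v
  simp only [mollify_apply, cocycle_translate, one_smul]
  exact (φ.norm_integral_shift_le (G := fun z => α.1 (T, z)) (by fun_prop) (hε T) hv).trans_eq
    (by ring)

end Mollification

section RuelleSullivan

variable [CompactSpace X] (μ : Ω.InvariantMeasure) (α : Ω.weakCocycles)

/-- The linear map whose matrix is the Ruelle–Sullivan matrix of the class of `α`. -/
noncomputable def ruelleSullivanMap : 𝔼 d →L[ℝ] 𝔼 d :=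
  Matrix.toEuclideanCLM (𝕜 := ℝ) (Ω.ruelleSullivan μ (QuotientAddGroup.mk α))

theorem integral_cocycle_add (i : Fin d) (x y : 𝔼 d) :
    ∫ T, α.1 (T, x + y) i ∂μ.toMeasure =
      ∫ T, α.1 (T, x) i ∂μ.toMeasure + ∫ T, α.1 (T, y) i ∂μ.toMeasure := by
  have htranslate := Ω.continuous_translate x
  have hα : Continuous fun T : Ω => α.1 (T, y) i := by fun_prop
  have hinvariant : ∫ T, α.1 (Ω.translate T x, y) i ∂μ.toMeasure =
      ∫ T, α.1 (T, y) i ∂μ.toMeasure := by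
    conv_rhs => rw [← μ.map_translate x]
    exact (integral_map htranslate.measurable.aemeasurable hα.aestronglyMeasurable).symm
  have hα_translate : Continuous fun T : Ω => α.1 (Ω.translate T x, y) i := hα.comp htranslate
  rw [← hinvariant, ← integral_add (Ω.integrable μ (by fun_prop)) (Ω.integrable μ hα_translate)]
  simp only [cocycle_add, PiLp.add_apply]

theorem integral_cocycle (i : Fin d) (v : 𝔼 d) :
    ∫ T, α.1 (T, v) i ∂μ.toMeasure = ruelleSullivanMap μ α v i := by
  have := μ.isProbabilityMeasure
  have hcont : Continuous fun v => ∫ T, α.1 (T, v) i ∂μ.toMeasure := by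
    simpa only [Measure.restrict_univ] using
      continuous_parametric_integral_of_continuous (μ := μ.toMeasure)
        (f := fun (v : 𝔼 d) (T : Ω) => α.1 (T, v) i) (by unfold Function.uncurry; fun_prop)
        isCompact_univ
  let l : 𝔼 d →L[ℝ] ℝ := (AddMonoidHom.mk' (fun v => ∫ T, α.1 (T, v) i ∂μ.toMeasure)
    (integral_cocycle_add μ α i)).toRealLinearMap hcont
  have hl : l = (EuclideanSpace.proj i).comp (ruelleSullivanMap μ α) := by
    refine ContinuousLinearMap.coe_injective
      ((EuclideanSpace.basisFun (Fin d) ℝ).toBasis.ext fun j => ?_)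
    have hentry : ruelleSullivanMap μ α (EuclideanSpace.single j 1) i =
        Ω.ruelleSullivan μ (QuotientAddGroup.mk α) i j := by simp [ruelleSullivanMap]
    rw [OrthonormalBasis.coe_toBasis, EuclideanSpace.basisFun_apply]
    exact hentry.symm
  exact DFunLike.congr_fun hl v

variable {μ} (hΩ : Ω.IsUniquelyErgodic) (φ : AveragingKernel (𝔼 d))

include hΩ

theorem IsUniquelyErgodic.tendstoUniformly_mollify (v : 𝔼 d) :
    TendstoUniformly (fun t T => (mollify φ t α).1 (T, v)) (fun _ => ruelleSullivanMap μ α v)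
      Filter.atTop := by
  have hμ : ∀ ρ : ProbabilityMeasure Ω,
      (∀ x, (ρ : Measure Ω).map (Ω.translationFlow x) = ρ) →
        ρ = ⟨μ.toMeasure, μ.isProbabilityMeasure⟩ := by
    intro ρ hρ
    obtain ⟨μ₀, hμ₀⟩ := hΩ
    exact Subtype.ext (congrArg InvariantMeasure.toMeasure
      ((hμ₀ ⟨ρ, inferInstance, hρ⟩).trans (hμ₀ μ).symm))
  have hlim := ProbabilityMeasure.tendsto_iff_forall_integral_tendsto.1
    (tendsto_orbitMeasure φ Ω.translationFlow hμ)
  rw [← tendsto_prod_top_iff, (PiLp.homeomorph 2 _).isInducing.tendsto_nhds_iff, tendsto_pi_nhds]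
  intro i
  have hαi : Continuous fun T : Ω => α.1 (T, v) i := by fun_prop
  have hi := hlim (BoundedContinuousFunction.mkOfCompact ⟨_, hαi⟩)
  simp only [BoundedContinuousFunction.mkOfCompact_apply, ContinuousMap.coe_mk,
    integral_orbitMeasure _ _ hαi, ProbabilityMeasure.coe_mk, integral_cocycle] at hi
  refine hi.congr fun q => ?_
  have hproj := (EuclideanSpace.proj (𝕜 := ℝ) i).integral_comp_comm
    (integrable_cocycle_translate_smul φ q.1 α q.2 v)
  rw [← mollify_apply] at hproj
  exact hproj

theorem IsUniquelyErgodic.eventually_forall_norm_mollify_sub_lt (r : ℝ) {ε : ℝ} (hε : 0 < ε) :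
    ∀ᶠ t in Filter.atTop, ∀ (T : Ω) (v : 𝔼 d), ‖v‖ ≤ r →
      ‖(mollify φ t α).1 (T, v) - ruelleSullivanMap μ α v‖ < ε := by
  set γ := α - linearCocycle Ω (ruelleSullivanMap μ α)
  obtain ⟨s, -, hs⟩ := (isCompact_closedBall (0 : 𝔼 d) r).elim_nhds_subcover _
    fun v _ => eventually_forall_norm_cocycle_sub_lt γ v (half_pos hε)
  filter_upwards [(Finset.eventually_all s).2 fun v _ => Metric.tendstoUniformly_iff.1
    (hΩ.tendstoUniformly_mollify (μ := μ) α φ v) _ (half_pos hε)] with t ht T w hw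
  obtain ⟨v, hv, hwv⟩ := Set.mem_iUnion₂.1 (hs (mem_closedBall_zero_iff.2 hw))
  have hv_near := ht v hv T
  rw [dist_comm, dist_eq_norm, ← mollify_sub_linearCocycle_apply] at hv_near
  have hvw := norm_mollify_sub_mollify_le φ t γ (fun S => (hwv S).le) T
  rw [← mollify_sub_linearCocycle_apply]
  linarith [norm_le_norm_add_norm_sub' ((mollify φ t γ).1 (T, w)) ((mollify φ t γ).1 (T, v))]

theorem IsUniquelyErgodic.exists_isBiLipschitz_mollify
    (hα : IsUnit (Ω.ruelleSullivan μ (QuotientAddGroup.mk α))) :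
    ∃ (t : ℝ) (K M : NNReal), IsBiLipschitz (mollify φ 1 (mollify φ t α)) K M := by
  obtain ⟨u, hu⟩ := hα.map (Matrix.toEuclideanCLM (n := Fin d) (𝕜 := ℝ))
  let A : 𝔼 d ≃L[ℝ] 𝔼 d := ContinuousLinearEquiv.unitsEquiv ℝ _ u
  have hA : (A : 𝔼 d →L[ℝ] 𝔼 d) = ruelleSullivanMap μ α := hu
  set W := volume.real (Metric.closedBall (0 : 𝔼 d) 2)
  obtain ⟨ε, hε, hεN⟩ := exists_pos_mul_lt one_pos
    (‖(A.symm : 𝔼 d →L[ℝ] 𝔼 d)‖ * (φ.lipConst * W))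
  obtain ⟨t, ht⟩ := (hΩ.eventually_forall_norm_mollify_sub_lt (μ := μ) α φ 2 hε).exists
  let c : NNReal := ⟨φ.lipConst * ε * W, by positivity⟩
  refine ⟨t, exists_isBiLipschitz_of_norm_sub_le _ A (c := c) ?_ fun T v => ?_⟩
  · rw [← NNReal.coe_lt_coe]
    calc ‖(A.symm : 𝔼 d →L[ℝ] 𝔼 d)‖ * (φ.lipConst * ε * W)
        = ‖(A.symm : 𝔼 d →L[ℝ] 𝔼 d)‖ * (φ.lipConst * W) * ε := by ring
      _ < 1 := hεN
  · set γ := mollify φ t α - linearCocycle Ω (ruelleSullivanMap μ α)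
    have hγ : ∀ (T : Ω) (v : 𝔼 d), ‖v‖ ≤ 2 → ‖γ.1 (T, v)‖ ≤ ε := fun T v hv => by
      rw [sub_linearCocycle_apply]
      exact (ht T v hv).le
    rw [← ContinuousLinearEquiv.coe_coe, hA, ← mollify_sub_linearCocycle_apply]
    exact norm_mollify_one_le φ γ hγ T v

end RuelleSullivan

end TilingSpace

theorem finite_image_of_forall_eq {A B C : Type*} {f : A → B} {g : A → C} {s : Set A}
    (hg : (g '' s).Finite) (h : ∀ a ∈ s, ∀ b ∈ s, g a = g b → f a = f b) : (f '' s).Finite := by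
  obtain ⟨t, hts, ht⟩ := Set.exists_subset_bijOn s f
  have hinj : Set.InjOn g t := fun a ha b hb hab =>
    ht.injOn ha hb (h a (hts ha) b (hts hb) hab)
  rw [← ht.image_eq]
  exact (Set.Finite.of_finite_image (hg.subset (Set.image_mono hts)) hinj).image f

namespace LabeledDelone

variable {d : ℕ} {X : Type u} {T T' : LabeledDelone d X} {R : ℝ}

theorem mem_patch {p : 𝔼 d × X} : p ∈ T.patch R ↔ p ∈ T.carrier ∧ ‖p.1‖ < R := Iff.rfl

theorem mem_iff_of_patch_eq (h : T.patch R = T'.patch R) {p : 𝔼 d × X} (hp : ‖p.1‖ < R) :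
    p ∈ T.carrier ↔ p ∈ T'.carrier := by
  simpa only [mem_patch, hp, and_true] using Set.ext_iff.1 h p

theorem patch_eq_of_le {R' : ℝ} (h : T.patch R' = T'.patch R') (hR : R ≤ R') :
    T.patch R = T'.patch R := by
  ext p
  simp only [mem_patch]
  exact and_congr_left fun hp => mem_iff_of_patch_eq h (hp.trans_le hR)

theorem patch_translate_eq {x : 𝔼 d} (h : T.patch (‖x‖ + R) = T'.patch (‖x‖ + R)) :
    (T.translate x).patch R = (T'.translate x).patch R := by
  ext p
  simp only [mem_patch, mem_translate]
  refine and_congr_left fun hp => mem_iff_of_patch_eq h ?_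
  simp only
  linarith [norm_add_le p.1 x]

theorem finite_patch [MetricSpace X] [CompactSpace X] (T : LabeledDelone d X) (R : ℝ) :
    (T.patch R).Finite :=
  (T.finite_inter ((isCompact_closedBall (0 : 𝔼 d) R).prod isCompact_univ)).subset fun _ hp =>
    ⟨hp.1, mem_closedBall_zero_iff.2 hp.2.le, trivial⟩

theorem RelativelyDenseWith.exists_norm_le_dist_le {S : Set (𝔼 d × X)} {R a : ℝ}
    (h : RelativelyDenseWith S R) (ha : 0 ≤ a) {x : 𝔼 d} (hx : a ≤ ‖x‖) :
    ∃ p ∈ S, ‖p.1‖ ≤ ‖x‖ - a + R ∧ dist x p.1 ≤ a + R := by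
  obtain ⟨y, hxy, hy⟩ := exists_dist_le_le (x := x) (z := 0) ha (sub_nonneg.2 hx) (by simp)
  obtain ⟨p, hp, hpy⟩ := h y
  rw [dist_zero_right] at hy
  rw [dist_comm] at hpy
  refine ⟨p, hp, ?_, (dist_triangle x y p.1).trans (add_le_add hxy hpy)⟩
  exact (norm_le_norm_add_norm_sub y p.1).trans (add_le_add hy (dist_eq_norm y p.1 ▸ hpy))

end LabeledDelone

namespace TilingSpace

open LabeledDelone

variable {d : ℕ} {X : Type u} [MetricSpace X] {Ω : TilingSpace d X}

section PatternEquivariance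

/-- The value of the cocycle at `(T, v)` depends only on the patch of `T` of radius `‖v‖ + R`: this
is strong pattern-equivariance with a radius controlled uniformly in `v`. -/
def HasPatchRadius (α : Ω.weakCocycles) (R : ℝ) : Prop :=
  ∀ (v : 𝔼 d) (T T' : Ω), T.1.patch (‖v‖ + R) = T'.1.patch (‖v‖ + R) → α.1 (T, v) = α.1 (T', v)

theorem exists_forall_mem_ball_eq_of_patch_eq {α : Ω.weakCocycles} (hα : α ∈ Ω.strongCocycles) :
    ∃ (v₀ : 𝔼 d) (δ R : ℝ), 0 < δ ∧ ∀ v ∈ Metric.ball v₀ δ, ∀ T T' : Ω,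
      T.1.patch R = T'.1.patch R → α.1 (T, v) = α.1 (T', v) := by
  let A : ℕ → Set (𝔼 d) := fun n =>
    {v | ∀ T T' : Ω, T.1.patch n = T'.1.patch n → α.1 (T, v) = α.1 (T', v)}
  have hclosed : ∀ n, IsClosed (A n) := fun n => by
    simp only [A, Set.ofPred_forall]
    exact isClosed_iInter fun T => isClosed_iInter fun T' => isClosed_iInter fun _ =>
      isClosed_eq (by fun_prop) (by fun_prop)
  have hunion : ⋃ n, A n = Set.univ := by
    refine Set.eq_univ_of_forall fun v => ?_
    obtain ⟨R, hR⟩ := hα v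
    obtain ⟨n, hn⟩ := exists_nat_ge R
    exact Set.mem_iUnion.2 ⟨n, fun T T' h => hR T T' (patch_eq_of_le h hn)⟩
  obtain ⟨n, v₀, hv₀⟩ := nonempty_interior_of_iUnion_of_closed hclosed hunion
  obtain ⟨δ, hδ, hball⟩ := Metric.mem_nhds_iff.1 (mem_interior_iff_mem_nhds.1 hv₀)
  exact ⟨v₀, δ, n, hδ, hball⟩

theorem exists_forall_norm_lt_eq_of_patch_eq {α : Ω.weakCocycles} (hα : α ∈ Ω.strongCocycles) :
    ∃ δ R : ℝ, 0 < δ ∧ ∀ w : 𝔼 d, ‖w‖ < δ → ∀ T T' : Ω,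
      T.1.patch R = T'.1.patch R → α.1 (T, w) = α.1 (T', w) := by
  obtain ⟨v₀, δ, R, hδ, hball⟩ := exists_forall_mem_ball_eq_of_patch_eq hα
  refine ⟨δ, ‖v₀‖ + R, hδ, fun w hw T T' h => ?_⟩
  have hdiff : ∀ T : Ω, α.1 (T, w) =
      α.1 (Ω.translate T (-v₀), v₀ + w) - α.1 (Ω.translate T (-v₀), v₀) := fun T => by
    rw [← cocycle_translate, translate_translate, neg_add_cancel, translate_zero]
  have hpatch : (Ω.translate T (-v₀)).1.patch R = (Ω.translate T' (-v₀)).1.patch R :=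
    patch_translate_eq (by rwa [norm_neg])
  rw [hdiff T, hdiff T', hball (v₀ + w) (by simpa using hw) _ _ hpatch,
    hball v₀ (Metric.mem_ball_self hδ) _ _ hpatch]

theorem cocycle_nsmul_eq_of_patch_eq (α : Ω.weakCocycles) {w : 𝔼 d} {R : ℝ}
    (h : ∀ T T' : Ω, T.1.patch R = T'.1.patch R → α.1 (T, w) = α.1 (T', w)) (n : ℕ) (T T' : Ω)
    (hpatch : T.1.patch (n * ‖w‖ + R) = T'.1.patch (n * ‖w‖ + R)) :
    α.1 (T, n • w) = α.1 (T', n • w) := by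
  induction n with
  | zero => simp only [zero_smul, cocycle_zero]
  | succ n ih =>
    have hpatch_n : T.1.patch (n * ‖w‖ + R) = T'.1.patch (n * ‖w‖ + R) := by
      refine patch_eq_of_le hpatch ?_
      rw [Nat.cast_succ]
      linarith [norm_nonneg w]
    have hnorm : ‖n • w‖ + R ≤ n * ‖w‖ + R := by gcongr; exact norm_nsmul_le
    rw [succ_nsmul, cocycle_add, cocycle_add, ih hpatch_n,
      h _ (Ω.translate T' (n • w)) (patch_translate_eq (patch_eq_of_le hpatch_n hnorm))]

theorem HasPatchRadius.mono {α : Ω.weakCocycles} {R R' : ℝ} (hα : HasPatchRadius α R)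
    (hR : R ≤ R') : HasPatchRadius α R' := fun v T T' h =>
  hα v T T' (patch_eq_of_le h (by gcongr))

theorem exists_hasPatchRadius {α : Ω.weakCocycles} (hα : α ∈ Ω.strongCocycles) :
    ∃ R, 0 ≤ R ∧ HasPatchRadius α R := by
  obtain ⟨δ, R, hδ, hsmall⟩ := exists_forall_norm_lt_eq_of_patch_eq hα
  suffices HasPatchRadius α R from ⟨max R 0, le_max_right _ _, this.mono (le_max_left _ _)⟩
  intro v T T' hpatch
  obtain ⟨n, w, rfl, hnorm, hw⟩ := exists_nsmul_eq_of_norm_lt hδ v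
  exact cocycle_nsmul_eq_of_patch_eq α (hsmall w hw) n T T' (by rwa [hnorm])

theorem IsStronglyPE.translate {s : Ω → 𝔼 d} (hs : Ω.IsStronglyPE s) (v : 𝔼 d) :
    Ω.IsStronglyPE fun T => s (Ω.translate T v) := by
  obtain ⟨R, hR⟩ := hs
  exact ⟨‖v‖ + R, fun T T' h => hR _ _ (patch_translate_eq h)⟩

variable [CompactSpace X]

theorem isStronglyPE_primitive (φ : AveragingKernel (𝔼 d)) (t : ℝ) {α : Ω.weakCocycles}
    (hα : α ∈ Ω.strongCocycles) : Ω.IsStronglyPE (primitive φ t α) := by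
  obtain ⟨R, -, hR⟩ := exists_hasPatchRadius hα
  refine ⟨|t| + R, fun T T' h => integral_congr_ae ?_⟩
  filter_upwards [φ.ae_norm_le_one] with z hz
  have hnorm : ‖t • z‖ ≤ |t| := by
    rw [norm_smul, Real.norm_eq_abs]
    exact mul_le_of_le_one_right (abs_nonneg t) hz
  exact hR (t • z) T T' (patch_eq_of_le h (by linarith))

theorem coboundary_mem_strongCocycles {s : C(Ω, 𝔼 d)} (hs : Ω.IsStronglyPE s) :
    coboundary s ∈ Ω.strongCocycles := fun v => by
  simpa only [coboundary_apply, sub_eq_add_neg] using (hs.translate v).add hs.neg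

theorem mollify_mem_strongCocycles (φ : AveragingKernel (𝔼 d)) (t : ℝ) {α : Ω.weakCocycles}
    (hα : α ∈ Ω.strongCocycles) : mollify φ t α ∈ Ω.strongCocycles :=
  Ω.strongCocycles.add_mem hα (coboundary_mem_strongCocycles (isStronglyPE_primitive φ t hα))

theorem mk_mollify_strong (φ : AveragingKernel (𝔼 d)) (t : ℝ) (α : Ω.strongCocycles) :
    (QuotientAddGroup.mk ⟨mollify φ t α.1, mollify_mem_strongCocycles φ t α.2⟩ : Ω.H1s) =
      QuotientAddGroup.mk α := by
  symm
  rw [QuotientAddGroup.eq]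
  refine ⟨primitive φ t α.1, isStronglyPE_primitive φ t α.2, fun T v => ?_⟩
  change (-α.1 + mollify φ t α.1).1 (T, v) = _
  rw [mollify, neg_add_cancel_left, coboundary_apply]

end PatternEquivariance

section FiniteLocalComplexity

variable (Ω) in
/-- The labeled points of norm less than `R` of the tilings that have a point at the origin, hence
the labeled positions of the points of any tiling relative to the points at distance less than
`R`. -/
def labeledDifferences (R : ℝ) : Set (𝔼 d × X) := ⋃ T ∈ Ω.transversal, T.1.patch R

theorem patch_subset_labeledDifferences {T : Ω} (hT : T ∈ Ω.transversal) (R : ℝ) :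
    T.1.patch R ⊆ Ω.labeledDifferences R :=
  Set.subset_biUnion_of_mem (u := fun T : Ω => T.1.patch R) hT

theorem IsFLC.finite_labeledDifferences [CompactSpace X] (hΩ : Ω.IsFLC) (R : ℝ) :
    (Ω.labeledDifferences R).Finite := by
  obtain ⟨F, hF, hFΩ⟩ := hΩ R
  have hfinite : (⋃ P ∈ {P ∈ F | P.Finite},
      Set.image2 (fun p q => (p.1 - q.1, p.2)) P P).Finite :=
    (hF.subset fun _ h => h.1).biUnion fun P hP => hP.2.image2 _ hP.2
  refine hfinite.subset (Set.iUnion₂_subset fun T hT p hp => ?_)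
  obtain ⟨P, hPF, v, hPT⟩ := hFΩ T
  have hP : P.Finite := by
    refine Set.Finite.of_finite_image (hPT ▸ T.1.finite_patch R) fun a _ b _ hab => ?_
    exact Prod.ext (add_right_cancel (Prod.ext_iff.1 hab).1) (Prod.ext_iff.1 hab).2
  obtain ⟨l, hl⟩ := mem_points.1 hT
  have horigin : (0, l) ∈ T.1.patch R := ⟨hl, by simpa using (norm_nonneg _).trans_lt hp.2⟩
  rw [hPT] at hp horigin
  obtain ⟨a, ha, rfl⟩ := hp
  obtain ⟨b, hb, hb_origin⟩ := horigin
  have hv : v = -b.1 := eq_neg_of_add_eq_zero_right (Prod.ext_iff.1 hb_origin).1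
  exact Set.mem_iUnion₂.2 ⟨P, ⟨hPF, hP⟩, a, ha, b, hb, by simp only [hv, sub_eq_add_neg]⟩

theorem isFLC_of_finite_labeledDifferences [CompactSpace X]
    (hΩ : ∀ R, (Ω.labeledDifferences R).Finite) : Ω.IsFLC := by
  intro R
  obtain ⟨_, R₀, -, -, hR₀⟩ := Ω.exists_uniform
  refine ⟨_, (hΩ (R + R₀)).finite_subsets, fun T => ?_⟩
  obtain ⟨p, hp, hpR₀⟩ := (hR₀ T).2 0
  rw [dist_zero_right] at hpR₀
  have hbij : Function.Bijective fun q : 𝔼 d × X => (q.1 + p.1, q.2) :=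
    ((Equiv.addRight p.1).prodCongr (Equiv.refl X)).bijective
  refine ⟨(fun q => (q.1 + p.1, q.2)) ⁻¹' T.1.patch R, fun q hq => ?_, p.1,
    (Set.image_preimage_eq _ hbij.surjective).symm⟩
  refine patch_subset_labeledDifferences
    (translate_mem_transversal_iff.2 (mem_points.2 ⟨p.2, hp⟩)) (R + R₀)
    (mem_patch.2 ⟨mem_translate.2 hq.1, ?_⟩)
  linarith [hq.2, norm_le_add_norm_add q.1 p.1]

theorem IsFLC.eventually_mem_carrier_iff [CompactSpace X] (hΩ : Ω.IsFLC) (T₀ : Ω) (p : 𝔼 d × X) :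
    ∀ᶠ T in 𝓝[Ω.transversal] T₀, p ∈ T.1.carrier ↔ p ∈ T₀.1.carrier := by
  by_cases hp : p ∈ T₀.1.carrier
  · have hfinite := hΩ.finite_labeledDifferences (‖p.1‖ + 1)
    have hnhds : ((Ω.labeledDifferences (‖p.1‖ + 1) \ {p})ᶜ ∩ {q | ‖q.1‖ < ‖p.1‖ + 1}) ∈ 𝓝 p :=
      Filter.inter_mem (hfinite.sdiff.isClosed.isOpen_compl.mem_nhds fun h => h.2 rfl)
        ((isOpen_lt (by fun_prop) continuous_const).mem_nhds (lt_add_one ‖p.1‖))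
    obtain ⟨δ, hδ, hball⟩ := Metric.mem_nhds_iff.1 hnhds
    filter_upwards [eventually_exists_dist_lt (continuous_subtype_val.continuousWithinAt) hp hδ,
      self_mem_nhdsWithin] with T ⟨q, hq, hqp⟩ hT
    obtain ⟨hq_isolated, hq_norm⟩ := hball hqp
    have hqD := patch_subset_labeledDifferences hT _ ⟨hq, hq_norm⟩
    obtain rfl : q = p := by_contra fun hne => hq_isolated ⟨hqD, hne⟩
    exact iff_of_true hq hp
  · have hopen : IsOpen {T : Ω | p ∉ T.1.carrier} :=
      (isClosed_setOf_mem_carrier p).isOpen_compl.preimage continuous_subtype_val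
    filter_upwards [nhdsWithin_le_nhds (hopen.mem_nhds hp)] with T hT using iff_of_false hT hp

theorem IsFLC.eventually_patch_eq [CompactSpace X] (hΩ : Ω.IsFLC) (R : ℝ) {T₀ : Ω}
    (hT₀ : T₀ ∈ Ω.transversal) : ∀ᶠ T in 𝓝[Ω.transversal] T₀, T.1.patch R = T₀.1.patch R := by
  filter_upwards [(Set.Finite.eventually_all (hΩ.finite_labeledDifferences R)).2 fun p _ =>
    hΩ.eventually_mem_carrier_iff T₀ p, self_mem_nhdsWithin] with T hTT₀ hT
  ext p
  exact ⟨fun hp => ⟨(hTT₀ p (patch_subset_labeledDifferences hT R hp)).1 hp.1, hp.2⟩,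
    fun hp => ⟨(hTT₀ p (patch_subset_labeledDifferences hT₀ R hp)).2 hp.1, hp.2⟩⟩

end FiniteLocalComplexity

section PatchLabel

variable (Ω) in
/-- The patch of radius `ρ`, as a label for the points of a deformed tiling. Intersecting with the
`labeledDifferences` changes nothing on the transversal, and makes the space of labels finite under
finite local complexity. -/
def patchLabel (ρ : ℝ) (T : Ω) : 𝒫 (Ω.labeledDifferences ρ) :=
  ⟨T.1.patch ρ ∩ Ω.labeledDifferences ρ, Set.inter_subset_right⟩

theorem patchLabel_congr {ρ : ℝ} {T T' : Ω} (h : T.1.patch ρ = T'.1.patch ρ) :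
    patchLabel Ω ρ T = patchLabel Ω ρ T' := by
  simp only [patchLabel, h]

theorem patch_eq_of_patchLabel_eq {ρ : ℝ} {T T' : Ω} (hT : T ∈ Ω.transversal)
    (hT' : T' ∈ Ω.transversal) (h : patchLabel Ω ρ T = patchLabel Ω ρ T') :
    T.1.patch ρ = T'.1.patch ρ := by
  rw [← Set.inter_eq_left.2 (patch_subset_labeledDifferences hT ρ),
    ← Set.inter_eq_left.2 (patch_subset_labeledDifferences hT' ρ)]
  exact congrArg Subtype.val h

theorem IsFLC.continuousOn_patchLabel [CompactSpace X] (hΩ : Ω.IsFLC) (ρ : ℝ)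
    [TopologicalSpace (𝒫 (Ω.labeledDifferences ρ))] :
    ContinuousOn (patchLabel Ω ρ) Ω.transversal := fun _ hT =>
  tendsto_const_nhds.congr' ((hΩ.eventually_patch_eq ρ hT).mono fun _ h =>
    (patchLabel_congr h).symm)

variable {α : Ω.weakCocycles} {K M : NNReal} {hα : IsBiLipschitz α K M} {ρ R R₀ : ℝ}

theorem patch_translate_eq_of_deform_eq {S S' : Ω}
    (hS : deform hα (patchLabel Ω ρ) S = deform hα (patchLabel Ω ρ) S') {y : 𝔼 d}
    (hy : y ∈ S.1.points) (hαy : α.1 (S, y) = α.1 (S', y)) :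
    (Ω.translate S y).1.patch ρ = (Ω.translate S' y).1.patch ρ := by
  obtain ⟨y', hy', hα', hL⟩ := exists_of_deform_eq hS hy
  obtain rfl : y' = y := (hα.antilipschitzWith S').injective (hα'.trans hαy)
  exact patch_eq_of_patchLabel_eq (translate_mem_transversal_iff.2 hy)
    (translate_mem_transversal_iff.2 hy') hL.symm

/-- A point `x` of `S` in the shell is close to a point `y` of `S` so deep inside the ball that
`α(S, y) = α(S', y)`; hence the label of the image of `y` also describes `S'` near `x`. -/
theorem patch_add_one_subset_of_deform_eq (hα_patch : HasPatchRadius α R₀) (hR₀ : 0 ≤ R₀)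
    (hR : 0 ≤ R) (hΩR : ∀ T : Ω, RelativelyDenseWith T.1.carrier R) (hρ : 2 * R + R₀ + 1 < ρ)
    {r : ℝ} (hr : ρ ≤ r) {S S' : Ω}
    (hS : deform hα (patchLabel Ω ρ) S = deform hα (patchLabel Ω ρ) S')
    (h : S.1.patch r = S'.1.patch r) : S.1.patch (r + 1) ⊆ S'.1.patch (r + 1) := by
  rintro ⟨x, l⟩ ⟨hx, hxr : ‖x‖ < r + 1⟩
  refine ⟨?_, hxr⟩
  rcases lt_or_ge ‖x‖ r with hx_ball | hx_shell
  · exact (mem_iff_of_patch_eq (p := (x, l)) h hx_ball).1 hx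
  obtain ⟨p, hp, hp_norm, hpx⟩ :=
    (hΩR S).exists_norm_le_dist_le (a := R + R₀ + 1) (by positivity) (x := x) (by linarith)
  have hαp : α.1 (S, p.1) = α.1 (S', p.1) :=
    hα_patch p.1 S S' (patch_eq_of_le h (by linarith))
  have hpatch := patch_translate_eq_of_deform_eq hS ⟨p, hp, rfl⟩ hαp
  have hx_near : ‖x - p.1‖ < ρ := by
    rw [← dist_eq_norm]
    linarith
  have hiff := mem_iff_of_patch_eq hpatch (p := (x - p.1, l)) hx_near
  simp only [translate, mem_translate, sub_add_cancel] at hiff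
  exact hiff.1 hx

theorem eq_of_deform_eq_of_mem_transversal (hα_patch : HasPatchRadius α R₀) (hR₀ : 0 ≤ R₀)
    (hR : 0 ≤ R) (hΩR : ∀ T : Ω, RelativelyDenseWith T.1.carrier R) (hρ : 2 * R + R₀ + 1 < ρ)
    {S S' : Ω} (hS : deform hα (patchLabel Ω ρ) S = deform hα (patchLabel Ω ρ) S')
    (hS_origin : S ∈ Ω.transversal) : S = S' := by
  have hpatch : ∀ n : ℕ, S.1.patch (ρ + n) = S'.1.patch (ρ + n) := by
    intro n
    induction n with
    | zero =>
      have h := patch_translate_eq_of_deform_eq hS hS_origin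
        ((cocycle_zero α S).trans (cocycle_zero α S').symm)
      simpa only [translate_zero, Nat.cast_zero, add_zero] using h
    | succ n ih =>
      have hn : ρ ≤ ρ + n := le_add_of_nonneg_right n.cast_nonneg
      rw [Nat.cast_succ, ← add_assoc]
      exact (patch_add_one_subset_of_deform_eq hα_patch hR₀ hR hΩR hρ hn hS ih).antisymm
        (patch_add_one_subset_of_deform_eq hα_patch hR₀ hR hΩR hρ hn hS.symm ih.symm)
  refine Subtype.ext (LabeledDelone.ext (Set.ext fun p => ?_))
  obtain ⟨n, hn⟩ := exists_nat_gt ‖p.1‖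
  exact mem_iff_of_patch_eq (hpatch n) (by linarith)

theorem deform_patchLabel_injective (hα : IsBiLipschitz α K M) (hα_patch : HasPatchRadius α R₀)
    (hR₀ : 0 ≤ R₀) (hR : 0 ≤ R) (hΩR : ∀ T : Ω, RelativelyDenseWith T.1.carrier R)
    (hρ : 2 * R + R₀ + 1 < ρ) : Function.Injective (deform hα (patchLabel Ω ρ)) := by
  intro T T' h
  obtain ⟨p, hp⟩ := T.1.nonempty_carrier
  have hpT : p.1 ∈ T.1.points := ⟨p, hp, rfl⟩
  obtain ⟨y, -, hy, -⟩ := exists_of_deform_eq h hpT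
  have htranslate : deform hα (patchLabel Ω ρ) (Ω.translate T p.1) =
      deform hα (patchLabel Ω ρ) (Ω.translate T' y) := by
    rw [deform_translate, deform_translate, h, hy]
  exact hα.eq_of_translate_eq (eq_of_deform_eq_of_mem_transversal hα_patch hR₀ hR hΩR hρ
    htranslate (translate_mem_transversal_iff.2 hpT)) hy.symm

variable [CompactSpace X]

theorem IsFLC.finite_image_deform_point (hΩ : Ω.IsFLC) (hα_patch : HasPatchRadius α ρ) (r : ℝ) :
    ((fun w : Ω × (𝔼 d × X) => (α.1 (w.1, w.2.1), patchLabel Ω ρ (Ω.translate w.1 w.2.1))) ''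
      {w | w.1 ∈ Ω.transversal ∧ ‖w.2.1‖ < r ∧ w.2 ∈ w.1.1.carrier}).Finite := by
  have hD := hΩ.finite_labeledDifferences (r + ρ)
  refine finite_image_of_forall_eq (g := fun w => (w.1.1.patch (r + ρ), w.2))
    ((hD.finite_subsets.prod (hΩ.finite_labeledDifferences r)).subset ?_) ?_
  · rintro _ ⟨⟨T, p⟩, ⟨hT, hpr, hp⟩, rfl⟩
    exact ⟨patch_subset_labeledDifferences hT _, patch_subset_labeledDifferences hT _ ⟨hp, hpr⟩⟩
  · rintro ⟨T, p⟩ ⟨-, hpr : ‖p.1‖ < r, -⟩ ⟨T', p'⟩ - h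
    obtain ⟨hpatch, rfl⟩ := Prod.ext_iff.1 h
    have hpatch_p := patch_eq_of_le hpatch (R := ‖p.1‖ + ρ) (by gcongr)
    exact Prod.ext (hα_patch p.1 T T' hpatch_p) (patchLabel_congr (patch_translate_eq hpatch_p))

theorem IsFLC.of_deform_patchLabel (hΩ : Ω.IsFLC) (hα_patch : HasPatchRadius α ρ)
    [MetricSpace (𝒫 (Ω.labeledDifferences ρ))] [CompactSpace (𝒫 (Ω.labeledDifferences ρ))]
    {Ω' : TilingSpace d (𝒫 (Ω.labeledDifferences ρ))}
    (hΩ' : ∀ S : Ω', ∃ T, S.1 = deform hα (patchLabel Ω ρ) T) : Ω'.IsFLC := by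
  refine isFLC_of_finite_labeledDifferences fun R => ?_
  refine (hΩ.finite_image_deform_point hα_patch (K * R)).subset
    (Set.iUnion₂_subset fun S hS q hq => ?_)
  obtain ⟨T, hT⟩ := hΩ' S
  have hT_origin : T ∈ Ω.transversal := by
    rw [transversal, Set.mem_ofPred_eq, hT, points_deform] at hS
    obtain ⟨x, hx, hx_zero⟩ := hS
    obtain rfl : x = 0 :=
      (hα.antilipschitzWith T).injective (hx_zero.trans (cocycle_zero α T).symm)
    exact hx
  rw [hT] at hq
  obtain ⟨⟨p, hp, rfl⟩, hpR : ‖α.1 (T, p.1)‖ < R⟩ := hq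
  exact ⟨(T, p), ⟨hT_origin, (hα.norm_le T p.1).trans_lt
    (mul_lt_mul_of_pos_left hpR hα.pos_left), hp⟩, rfl⟩

theorem IsFLC.exists_homeomorph (hΩ : Ω.IsFLC) (hα : IsBiLipschitz α K M)
    (hα_strong : α ∈ Ω.strongCocycles) :
    ∃ (Y : Type u) (_ : MetricSpace Y) (_ : CompactSpace Y) (Ω' : TilingSpace d Y) (h : Ω ≃ₜ Ω'),
      IsShapeDeformation Ω Ω' α h ∧ (Ω.IsAperiodic → Ω'.IsAperiodic) ∧ Ω'.IsFLC := by
  obtain ⟨R₀, hR₀, hα_patch⟩ := exists_hasPatchRadius hα_strong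
  obtain ⟨_, R, -, hR, hΩR⟩ := Ω.exists_uniform
  set ρ := 2 * R + R₀ + 2
  have : Finite (𝒫 (Ω.labeledDifferences ρ)) :=
    (hΩ.finite_labeledDifferences ρ).finite_subsets.to_subtype
  let : MetricSpace (𝒫 (Ω.labeledDifferences ρ)) :=
    MetricSpace.induced (fun Q => ((Finite.equivFin _ Q : ℕ) : ℝ))
      (Nat.cast_injective.comp (Fin.val_injective.comp (Equiv.injective _))) inferInstance
  have hinj := deform_patchLabel_injective hα hα_patch hR₀ hR.le (fun T => (hΩR T).2)
    (ρ := ρ) (by linarith)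
  obtain ⟨Ω', h, hdef, hshape, haper⟩ :=
    exists_homeomorph_deform hα (hΩ.continuousOn_patchLabel ρ) hinj
  refine ⟨_, _, inferInstance, Ω', h, hshape, haper,
    hΩ.of_deform_patchLabel (hα := hα) (hα_patch.mono (by linarith)) fun S => ?_⟩
  obtain ⟨T, rfl⟩ := h.surjective S
  exact ⟨T, hdef T⟩

end PatchLabel

end TilingSpace

theorem mainTheorem2 {d : ℕ} {X : Type u} [MetricSpace X] [CompactSpace X]
    (Ω : TilingSpace d X) (hΩ : Ω.IsUniquelyErgodic) (μ : Ω.InvariantMeasure) :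
    (∀ c : Ω.H1w, IsUnit (Ω.ruelleSullivan μ c) →
      ∃ α₀ : Ω.weakCocycles, (QuotientAddGroup.mk α₀ : Ω.H1w) = c ∧
        ∃ (Y : Type u) (_ : MetricSpace Y) (_ : CompactSpace Y) (Ω' : TilingSpace d Y)
          (h : Ω ≃ₜ Ω'),
          IsShapeDeformation Ω Ω' α₀ h ∧ (Ω.IsAperiodic → Ω'.IsAperiodic)) ∧
    (Ω.IsFLC → ∀ c : Ω.H1s, IsUnit (Ω.ruelleSullivan μ (Ω.strongToWeak c)) →
      ∃ α₀ : Ω.strongCocycles, (QuotientAddGroup.mk α₀ : Ω.H1s) = c ∧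
        ∃ (Y : Type u) (_ : MetricSpace Y) (_ : CompactSpace Y) (Ω' : TilingSpace d Y)
          (h : Ω ≃ₜ Ω'),
          IsShapeDeformation Ω Ω' α₀.1 h ∧ (Ω.IsAperiodic → Ω'.IsAperiodic) ∧ Ω'.IsFLC) := by
  obtain ⟨φ⟩ : Nonempty (AveragingKernel (EuclideanSpace ℝ (Fin d))) := inferInstance
  constructor
  · intro c hc
    obtain ⟨α, rfl⟩ := QuotientAddGroup.mk_surjective c
    obtain ⟨t, K, M, hα⟩ := hΩ.exists_isBiLipschitz_mollify α φ hc
    exact ⟨_, (TilingSpace.mk_mollify φ 1 _).trans (TilingSpace.mk_mollify φ t α),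
      hα.exists_homeomorph⟩
  · intro hflc c hc
    obtain ⟨α, rfl⟩ := QuotientAddGroup.mk_surjective c
    obtain ⟨t, K, M, hα⟩ := hΩ.exists_isBiLipschitz_mollify α.1 φ hc
    have hs := TilingSpace.mollify_mem_strongCocycles φ t α.2
    have hs₁ := TilingSpace.mollify_mem_strongCocycles φ 1 hs
    exact ⟨⟨_, hs₁⟩,
      (TilingSpace.mk_mollify_strong φ 1 ⟨_, hs⟩).trans (TilingSpace.mk_mollify_strong φ t α),
      hflc.exists_homeomorph hα hs₁⟩
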